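/- Let $\Gamma$ be a finite group with set of conjugacy classes $\Gamma_*$ and let $n\ge 0$. Let $\widetilde S_n$ be the group generated by $z,t_1,\dots,t_{n-1}$ subject to the relations $z^2=1$, $t_i^2=(t_it_{i+1})^3=z$, $t_it_j=z\,t_jt_i$ for $i>j+1$, and $zt_i=t_iz$, and let $\theta_n:\widetilde S_n\to S_n$ be the homomorphism with $\theta_n(t_i)=(i,i+1)$ and $\theta_n(z)=1$. Let $\Gamma\wr S_n=\Gamma^n\rtimes S_n$ and $\Gamma\wr\widetilde S_n=\Gamma^n\rtimes\widetilde S_n$, where $S_n$ acts on $\Gamma^n$ by $(\sigma g)_i=g_{\sigma^{-1}(i)}$ and $\widetilde S_n$ acts through $\theta_n$; write again $\theta_n$ for the map $\Gamma\wr\widetilde S_n\to\Gamma\wr S_n$, $(g,t)\mapsto(g,\theta_n(t))$. The type of $(g,\sigma)\in\Gamma\wr S_n$ is the family of partitions $\rho=(\rho(c))_{c\in\Gamma_*}$ in which the parts of $\rho(c)$ are the lengths of those cycles $(i_1\,i_2\cdots i_k)$ of $\sigma$ (fixed points included) whose cycle product $g_{i_k}g_{i_{k-1}}\cdots g_{i_1}$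 lies in $c$; it depends only on the conjugacy class of $(g,\sigma)$, and $\sum_c|\rho(c)|=n$. A conjugacy class of $\Gamma\wr S_n$ is called even or odd according to the parity of the permutation $\sigma$ of any of its elements $(g,\sigma)$. Let $\mathcal{OP}_n(\Gamma_*)$ be the set of families $\rho$ of partitions indexed by $\Gamma_*$ of total size $n$ all of whose parts are odd, and let $\mathcal{SP}^1_n(\Gamma_*)$ be the set of those families of total size $n$ for which every $\rho(c)$ is strict (its parts are pairwise distinct) and $n$ minus the total number of parts is odd. Theorem. Let $C_\rho$ be a conjugacy class of $\Gamma\wr S_n$, of type $\rho$. Then the preimage $\theta_n^{-1}(C_\rho)$ is the union of two distinct conjugacy classes of $\Gamma\wr\widetilde S_n$ if and only if one of the following holds: (1) $C_\rho$ is even and all parts of all the partitions $\rho(c)$ are odd; equivalently, $\rho\in\mathcal{OP}_n(\Gamma_*)$; (2) $C_\rho$ is odd and all the partitions $\rho(c)$ are strict; equivalently, $\rho\in\mathcal{SP}^1_n(\Gamma_*)$. -/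

import Mathlib

noncomputable section

namespace SpinWreath

/-! ### The spin group, a double cover of the symmetric group -/

/-- Generators of the spin group: `z` and `t i`. With `0`-based indices, `t i` stands for the
transposition of the letters `i` and `i + 1` of `Fin n`. -/
inductive SpinGen (n : ℕ) : Type
  | z : SpinGen n
  | t (i : Fin (n - 1)) : SpinGen n

/-- The free generator `z`. -/
def fz (n : ℕ) : FreeGroup (SpinGen n) := FreeGroup.of SpinGen.z

/-- The free generator `t i`. -/
def ft {n : ℕ} (i : Fin (n - 1)) : FreeGroup (SpinGen n) := FreeGroup.of (SpinGen.t i)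

/-- Defining relators of the spin group, a relation `a = b` being written as the relator
`a * b⁻¹`. -/
inductive SpinRel (n : ℕ) : FreeGroup (SpinGen n) → Prop
  | z_sq : SpinRel n (fz n ^ 2)
  | t_sq (i : Fin (n - 1)) : SpinRel n (ft i ^ 2 * (fz n)⁻¹)
  | braid (i j : Fin (n - 1)) (h : (j : ℕ) = i + 1) :
      SpinRel n ((ft i * ft j) ^ 3 * (fz n)⁻¹)
  | far (i j : Fin (n - 1)) (h : (j : ℕ) + 1 < i) :
      SpinRel n ((ft i * ft j) * (fz n * ft j * ft i)⁻¹)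
  | comm (i : Fin (n - 1)) : SpinRel n ((fz n * ft i) * (ft i * fz n)⁻¹)

/-- The spin group: generated by `z` and the `t i`, subject to `z ^ 2 = 1`,
`t i ^ 2 = (t i * t (i + 1)) ^ 3 = z`, `t i * t j = z * t j * t i` for `j + 1 < i`, and
`z * t i = t i * z`. -/
abbrev SpinGroup (n : ℕ) : Type := PresentedGroup {r | SpinRel n r}

/-- The transposition `(i, i + 1)`. -/
def adjSwap {n : ℕ} (i : Fin (n - 1)) : Equiv.Perm (Fin n) :=
  Equiv.swap ⟨i, by omega⟩ ⟨i + 1, by omega⟩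

/-- The values of the covering map on the generators. -/
def thetaGen (n : ℕ) : SpinGen n → Equiv.Perm (Fin n)
  | SpinGen.z => 1
  | SpinGen.t i => adjSwap i

theorem thetaGen_rel (n : ℕ) : ∀ r ∈ {r | SpinRel n r}, FreeGroup.lift (thetaGen n) r = 1 := by
  rintro r (_ | i | ⟨i, j, h⟩ | ⟨i, j, h⟩ | i)
  · simp [fz, thetaGen]
  · simp [fz, ft, thetaGen, adjSwap, pow_two]
  · simp only [fz, ft, map_mul, map_pow, map_inv, FreeGroup.lift_apply_of, thetaGen, adjSwap,
      inv_one, mul_one, h]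
    rw [Equiv.swap_comm]
    have h3 := (Equiv.Perm.isThreeCycle_swap_mul_swap_same (a := (⟨i + 1, by omega⟩ : Fin n))
      (b := ⟨i, by omega⟩) (c := ⟨i + 1 + 1, by omega⟩) (by simp [Fin.ext_iff])
      (by simp [Fin.ext_iff]) (by simp [Fin.ext_iff]; omega)).orderOf
    rw [← h3]
    exact pow_orderOf_eq_one _
  · simp only [fz, ft, map_mul, map_inv, FreeGroup.lift_apply_of, thetaGen, one_mul]
    rw [mul_inv_eq_one]
    refine (Equiv.Perm.Disjoint.commute ?_).eq
    unfold adjSwap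
    intro k
    by_cases hk : (k : ℕ) = i ∨ (k : ℕ) = i + 1
    · right
      refine Equiv.swap_apply_of_ne_of_ne ?_ ?_ <;> simp only [ne_eq, Fin.ext_iff] <;> omega
    · left
      refine Equiv.swap_apply_of_ne_of_ne ?_ ?_ <;> simp only [ne_eq, Fin.ext_iff] <;> omega
  · simp [fz, ft, thetaGen]

/-- The covering map from the spin group to the symmetric group: `t i ↦ (i, i + 1)`, `z ↦ 1`. -/
def theta (n : ℕ) : SpinGroup n →* Equiv.Perm (Fin n) := PresentedGroup.toGroup (thetaGen_rel n)

/-! ### Wreath products -/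

variable (Γ : Type*) [Group Γ] (n : ℕ)

/-- The wreath product of `Γ` with the symmetric group: pairs `(g, s)` with
`(g, s) * (h, t) = (g * s • h, s * t)`, where `(s • h) i = h (s⁻¹ i)`. -/
abbrev Wreath : Type _ :=
  (Fin n → Γ) ⋊[(mulAutArrow : Equiv.Perm (Fin n) →* MulAut (Fin n → Γ))] Equiv.Perm (Fin n)

/-- The spin wreath product of `Γ`, with the spin group acting through the symmetric group. -/
abbrev SpinWreathProd : Type _ :=
  (Fin n → Γ) ⋊[(mulAutArrow : Equiv.Perm (Fin n) →* MulAut (Fin n → Γ)).comp (theta n)]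
    SpinGroup n

/-- The covering map `(g, t) ↦ (g, θ t)` from the spin wreath product to the wreath product. -/
def wreathTheta : SpinWreathProd Γ n →* Wreath Γ n :=
  SemidirectProduct.map (MonoidHom.id _) (theta n) (fun _ => rfl)

/-! ### Partition-valued functions -/

/-- Families, indexed by a finite set `X`, of partitions of total size `n`. A partition is given
by the multiset of its (positive) parts. -/
@[ext]
structure PartitionFun (X : Type*) [Finite X] (n : ℕ) where
  /-- the parts of the partition at `x` -/
  parts : X → Multiset ℕ
  parts_pos : ∀ x, ∀ m ∈ parts x, 0 < m
  norm_eq : ∑ᶠ x, (parts x).sum = n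

namespace PartitionFun

variable {X : Type*} [Finite X] {n : ℕ}

/-- The total number of parts. -/
def length (ρ : PartitionFun X n) : ℕ := ∑ᶠ x, (ρ.parts x).card

/-- The total size minus the total number of parts. -/
def d (ρ : PartitionFun X n) : ℤ := (n : ℤ) - ρ.length

/-- All the parts of all the partitions are odd. -/
def AllOdd (ρ : PartitionFun X n) : Prop := ∀ x, ∀ m ∈ ρ.parts x, Odd m

/-- Each of the partitions is strict: it has no repeated part. -/
def Strict (ρ : PartitionFun X n) : Prop := ∀ x, (ρ.parts x).Nodup

end PartitionFun

/-- The families of total size `n` all of whose parts are odd. -/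
def OP (X : Type*) [Finite X] (n : ℕ) : Set (PartitionFun X n) := {ρ | ρ.AllOdd}

/-- The odd families of strict partitions of total size `n`. -/
def SPOdd (X : Type*) [Finite X] (n : ℕ) : Set (PartitionFun X n) := {ρ | Odd ρ.d ∧ ρ.Strict}

/-! ### The type of an element and of a conjugacy class of the wreath product -/

variable {Γ n}

/-- The product `g (σ^(m-1) i) * ⋯ * g (σ i) * g i`. -/
def partialProd (x : Wreath Γ n) (i : Fin n) (m : ℕ) : Γ :=
  ((List.range m).map fun j => x.left ((x.right ^ j) i)).reverse.prod

/-- The cycle product `g_{i_k} * ⋯ * g_{i_1}` of `x = (g, σ)` along the cycle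
`(i_1 i_2 ⋯ i_k)` of `σ`, started at `i_1 = i`. -/
def cycleProd (x : Wreath Γ n) (i : Fin n) : Γ :=
  partialProd x i (Function.minimalPeriod x.right i)

theorem partialProd_succ (x : Wreath Γ n) (i : Fin n) (m : ℕ) :
    partialProd x i (m + 1) = x.left ((x.right ^ m) i) * partialProd x i m := by
  simp [partialProd, List.range_succ]

theorem partialProd_succ' (x : Wreath Γ n) (i : Fin n) (m : ℕ) :
    partialProd x i (m + 1) = partialProd x (x.right i) m * x.left i := by
  induction m with
  | zero => simp [partialProd]
  | succ m ih =>
    rw [partialProd_succ, ih, partialProd_succ, pow_succ, Equiv.Perm.mul_apply, mul_assoc]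

theorem pow_minimalPeriod (σ : Equiv.Perm (Fin n)) (i : Fin n) :
    (σ ^ Function.minimalPeriod σ i) i = i := by
  rw [Equiv.Perm.coe_pow]
  exact Function.iterate_minimalPeriod

theorem minimalPeriod_right (σ : Equiv.Perm (Fin n)) (i : Fin n) :
    Function.minimalPeriod σ (σ i) = Function.minimalPeriod σ i :=
  Function.minimalPeriod_apply (σ.injective.mem_periodicPts i)

theorem isConj_cycleProd_right (x : Wreath Γ n) (i : Fin n) :
    IsConj (cycleProd x i) (cycleProd x (x.right i)) := by
  rw [isConj_iff]
  refine ⟨x.left i, ?_⟩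
  have h1 := partialProd_succ x i (Function.minimalPeriod x.right i)
  rw [partialProd_succ', pow_minimalPeriod] at h1
  rw [cycleProd, cycleProd, minimalPeriod_right, ← h1]
  group

theorem cycle_invariants (x : Wreath Γ n) {i j : Fin n} (h : x.right.SameCycle i j) :
    Function.minimalPeriod x.right i = Function.minimalPeriod x.right j ∧
      IsConj (cycleProd x i) (cycleProd x j) := by
  obtain ⟨k, rfl⟩ := h.exists_nat_pow_eq
  clear h
  induction k with
  | zero => exact ⟨rfl, IsConj.refl _⟩
  | succ k ih =>
    rw [pow_succ', Equiv.Perm.mul_apply]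
    exact ⟨ih.1.trans (minimalPeriod_right _ _).symm, ih.2.trans (isConj_cycleProd_right x _)⟩

/-- The cycles of a permutation, fixed points included. -/
abbrev Cycles (σ : Equiv.Perm (Fin n)) : Type := Quotient (Equiv.Perm.SameCycle.setoid σ)

/-- The length of a cycle. -/
def cycleLength (x : Wreath Γ n) : Cycles x.right → ℕ :=
  Quotient.lift (fun i => Function.minimalPeriod x.right i)
    (fun _ _ h => (cycle_invariants x h).1)

/-- The conjugacy class of the cycle product of a cycle. -/
def cycleClass (x : Wreath Γ n) : Cycles x.right → ConjClasses Γ :=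
  Quotient.lift (fun i => ConjClasses.mk (cycleProd x i))
    (fun _ _ h => ConjClasses.mk_eq_mk_iff_isConj.2 (cycle_invariants x h).2)

open Classical in
/-- The lengths of the cycles of `x = (g, σ)` whose cycle products lie in the class `c`. -/
def typeParts (x : Wreath Γ n) (c : ConjClasses Γ) : Multiset ℕ :=
  ((Finset.univ : Finset (Cycles x.right)).filter fun y => cycleClass x y = c).val.map
    (cycleLength x)

theorem cycleLength_pos (x : Wreath Γ n) (y : Cycles x.right) : 0 < cycleLength x y := by
  induction y using Quotient.inductionOn with
  | _ i => exact Function.minimalPeriod_pos_of_mem_periodicPts (x.right.injective.mem_periodicPts i)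

theorem cycleLength_eq_card (x : Wreath Γ n) (y : Cycles x.right) :
    cycleLength x y = Nat.card {i : Fin n // (Quotient.mk _ i : Cycles x.right) = y} := by
  classical
  induction y using Quotient.inductionOn with
  | _ i =>
    change Function.minimalPeriod x.right i = _
    have h := MulAction.minimalPeriod_eq_card (a := x.right) (b := i)
    rw [← Nat.card_eq_fintype_card] at h
    refine Eq.trans h (Nat.card_congr (Equiv.subtypeEquivRight fun j => ?_))
    rw [Quotient.eq, MulAction.mem_orbit_iff]
    constructor
    · rintro ⟨⟨_, k, rfl⟩, rfl⟩
      exact Equiv.Perm.SameCycle.symm ⟨k, rfl⟩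
    · intro hj
      obtain ⟨k, hk⟩ := Equiv.Perm.SameCycle.symm hj
      exact ⟨⟨x.right ^ k, k, rfl⟩, hk⟩

theorem sum_cycleLength (x : Wreath Γ n) [Fintype (Cycles x.right)] :
    ∑ y, cycleLength x y = n := by
  simp_rw [cycleLength_eq_card]
  rw [← Nat.card_sigma, Nat.card_congr (Equiv.sigmaFiberEquiv _), Nat.card_fin]

/-- The type of an element of the wreath product. -/
def typeOf [Finite Γ] (x : Wreath Γ n) : PartitionFun (ConjClasses Γ) n where
  parts := typeParts x
  parts_pos c m hm := by
    obtain ⟨y, -, rfl⟩ := Multiset.mem_map.1 hm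
    exact cycleLength_pos x y
  norm_eq := by
    classical
    let _ : Fintype (ConjClasses Γ) := Fintype.ofFinite _
    rw [finsum_eq_sum_of_fintype]
    refine Eq.trans ?_ (sum_cycleLength x)
    exact Finset.sum_fiberwise Finset.univ (cycleClass x) (cycleLength x)

section Conj

variable (w x : Wreath Γ n)

theorem conj_right : (w * x * w⁻¹).right = w.right * x.right * w.right⁻¹ := rfl

theorem conj_right_apply (i : Fin n) :
    (w * x * w⁻¹).right (w.right i) = w.right (x.right i) := by
  simp

theorem conj_right_pow_apply (k : ℕ) (i : Fin n) :
    ((w * x * w⁻¹).right ^ k) (w.right i) = w.right ((x.right ^ k) i) := by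
  simp [conj_pow]

theorem conj_left_apply (i : Fin n) :
    (w * x * w⁻¹).left (w.right (x.right i)) =
      w.left (w.right (x.right i)) * x.left (x.right i) * (w.left (w.right i))⁻¹ := by
  have act : ∀ (s : Equiv.Perm (Fin n)) (h : Fin n → Γ) (k : Fin n),
      (mulAutArrow s h : Fin n → Γ) k = h (s⁻¹ k) := fun _ _ _ => rfl
  simp only [SemidirectProduct.mul_left, SemidirectProduct.mul_right, SemidirectProduct.inv_left,
    Pi.mul_apply, Pi.inv_apply, act, map_inv]
  simp
  rfl

theorem conj_minimalPeriod (i : Fin n) :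
    Function.minimalPeriod (w * x * w⁻¹).right (w.right i) =
      Function.minimalPeriod x.right i := by
  refine Function.minimalPeriod_eq_minimalPeriod_iff.2 fun k => ?_
  simp only [Function.IsPeriodicPt, Function.IsFixedPt, ← Equiv.Perm.coe_pow,
    conj_right_pow_apply, EmbeddingLike.apply_eq_iff_eq]

theorem conj_partialProd (i : Fin n) (m : ℕ) :
    partialProd (w * x * w⁻¹) (w.right (x.right i)) m =
      w.left (w.right ((x.right ^ m) i)) * partialProd x (x.right i) m *
        (w.left (w.right i))⁻¹ := by
  induction m with
  | zero => simp [partialProd]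
  | succ m ih =>
    have hp : (x.right ^ m) (x.right i) = x.right ((x.right ^ m) i) := by
      rw [← Equiv.Perm.mul_apply, ← pow_succ, pow_succ', Equiv.Perm.mul_apply]
    rw [partialProd_succ, partialProd_succ, ih, conj_right_pow_apply, hp, conj_left_apply,
      pow_succ', Equiv.Perm.mul_apply]
    group

theorem conj_cycleProd (i : Fin n) :
    IsConj (cycleProd x i) (cycleProd (w * x * w⁻¹) (w.right i)) := by
  obtain ⟨i, rfl⟩ := x.right.surjective i
  rw [isConj_iff]
  refine ⟨w.left (w.right i), ?_⟩
  rw [cycleProd, cycleProd, conj_minimalPeriod, conj_partialProd, minimalPeriod_right,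
    pow_minimalPeriod]

/-- Conjugation by `w` carries the cycles of `x` to those of `w * x * w⁻¹`. -/
def conjCycles : Cycles x.right ≃ Cycles (w * x * w⁻¹).right :=
  Quotient.congr w.right fun i j => by
    change x.right.SameCycle i j ↔
      (w.right * x.right * w.right⁻¹).SameCycle (w.right i) (w.right j)
    simp [Equiv.Perm.sameCycle_conj]

theorem typeParts_conj : typeParts (w * x * w⁻¹) = typeParts x := by
  classical
  have hl : ∀ y, cycleLength (w * x * w⁻¹) (conjCycles w x y) = cycleLength x y := by
    intro y
    induction y using Quotient.inductionOn with
    | _ i => exact conj_minimalPeriod w x i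
  have hc : ∀ y, cycleClass (w * x * w⁻¹) (conjCycles w x y) = cycleClass x y := by
    intro y
    induction y using Quotient.inductionOn with
    | _ i => exact ConjClasses.mk_eq_mk_iff_isConj.2 (conj_cycleProd w x i).symm
  funext c
  unfold typeParts
  rw [← Finset.map_univ_equiv (conjCycles w x), Finset.filter_map, Finset.map_val,
    Multiset.map_map]
  simp [Function.comp_def, hl, hc]

end Conj

/-- The type of a conjugacy class of the wreath product: the common type of its elements. -/
def classType [Finite Γ] : ConjClasses (Wreath Γ n) → PartitionFun (ConjClasses Γ) n :=
  Quotient.lift typeOf fun x y h => by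
    obtain ⟨w, rfl⟩ := isConj_iff.1 h
    exact PartitionFun.ext (typeParts_conj w x).symm

/-- A conjugacy class of the wreath product is even if its elements `(g, σ)` have `σ` even. -/
def ClassEven (C : ConjClasses (Wreath Γ n)) : Prop :=
  ∀ x ∈ C.carrier, Equiv.Perm.sign x.right = 1

/-- A conjugacy class of the wreath product is odd if its elements `(g, σ)` have `σ` odd. -/
def ClassOdd (C : ConjClasses (Wreath Γ n)) : Prop :=
  ∀ x ∈ C.carrier, Equiv.Perm.sign x.right = -1

/-- The subset `S` of the group `G` is the union of two distinct conjugacy classes of `G`. -/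
def SplitsIntoTwo {G : Type*} [Group G] (S : Set G) : Prop :=
  ∃ D₁ D₂ : ConjClasses G, D₁ ≠ D₂ ∧ S = D₁.carrier ∪ D₂.carrier

end SpinWreath

end

/-!
The spin group is a central extension of the symmetric group with kernel `{1, z}`, and `z ≠ 1`. The
kernel is found by a coset decomposition: modulo `z` the relations become the Coxeter relations of
type `A`, and these present the symmetric group (`eq_one_of_coxeter`). That `z ≠ 1` is seen in a
Clifford algebra, where `z` acts as `-1` and `t i` as the root `eᵢ - eᵢ₊₁` (`spinZ_ne_one`).

Hence the preimage of the class of `x = (g, σ)` is either one class or two, and it is two exactly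
when the lifts of `w.right` and `σ` to the spin group commute for every `w` in the centralizer of
`x` (`splitsIntoTwo_iff`). The main tool for deciding this is that lifts of disjoint permutations
`α`, `β` commute, except that they commute up to `z` when both are odd
(`mul_eq_koszul_mul_of_disjoint`). So the lift of a cycle `c` of `σ` commutes with the lift of `σ`
unless `c` and `σ * c⁻¹` are both odd (`mul_eq_koszul_mul_of_cycleOf`). Four cases remain.

* If all cycles have odd length then `σ` has odd order `m`. If the lifts `b` and `z * b` of `σ` were
  conjugate, their `m`-th powers would agree, being central, but they differ by `z ^ m = z`
  (`mul_comm_of_odd_pow_eq_one`).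
* If `σ` is odd and the type is strict, then an element of the centralizer maps every cycle of `σ`
  to itself, so its permutation is a product of powers of cycles of `σ`. As `σ` is odd, the lifts of
  these cycles commute with that of `σ` (`mul_comm_of_sameCycle`).
* If `σ` is even and has a cycle of even length, the restriction of `x` to that cycle lies in the
  centralizer, and its lift does not commute with that of `σ` (`not_splitsIntoTwo_of_even`).
* If `σ` is odd and two cycles of `σ` have the same length `k` and conjugate cycle products, the
  centralizer contains an element over the involution that exchanges them (`exists_cycleSwap`).
  Commuting its lift past the rest of `σ` gives the sign `(-1) ^ k`, and exchanging the lifts of the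
  two cycles gives `(-1) ^ (k - 1)`, so the lifts do not commute (`mul_eq_spinZ_mul_of_cycleSwap`).
-/

noncomputable section

namespace SpinWreath

variable {n : ℕ} {Γ : Type*} [Group Γ]

/-! ### Groups with the Coxeter relations of type A -/

/-- The word `s (k + l - 1) * ⋯ * s (k + 1) * s k`, a minimal representative of a right
coset of `S_{k + l}` in `S_{k + l + 1}` when the `s i` are the adjacent transpositions. -/
def descWord {G : Type*} [Group G] (s : ℕ → G) : ℕ → ℕ → G
  | _, 0 => 1
  | k, l + 1 => descWord s (k + 1) l * s k

section Coxeter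

variable {G : Type*} [Group G] {s : ℕ → G} {N : ℕ}

theorem descWord_mul_of_lt (far : ∀ i j, i + 1 < j → j < N → s i * s j = s j * s i) (l : ℕ) :
    ∀ k i, i + 1 < k → k + l ≤ N → descWord s k l * s i = s i * descWord s k l := by
  induction l with
  | zero => intro k i _ _; simp [descWord]
  | succ l ih =>
    intro k i hi hk
    rw [descWord, mul_assoc, ← far i k hi (by omega), ← mul_assoc,
      ih (k + 1) i (by omega) (by omega), mul_assoc]

/-- Moving `s (i + 1)` leftwards through a descending word shifts its index down by one. -/
theorem descWord_mul_of_gt (far : ∀ i j, i + 1 < j → j < N → s i * s j = s j * s i)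
    (braid : ∀ i, i + 1 < N → s i * s (i + 1) * s i = s (i + 1) * s i * s (i + 1)) (l : ℕ) :
    ∀ k i, k ≤ i → i + 1 < k + l → k + l ≤ N →
      descWord s k l * s (i + 1) = s i * descWord s k l := by
  induction l with
  | zero => intro k i _ _ _; omega
  | succ l ih =>
    intro k i hi hil hk
    rcases hi.eq_or_lt with rfl | hi
    · obtain ⟨l, rfl⟩ : ∃ l', l = l' + 1 := ⟨l - 1, by omega⟩
      rw [descWord, descWord, mul_assoc, mul_assoc, ← mul_assoc (s (k + 1)), ← braid k (by omega),
        ← mul_assoc, ← mul_assoc, descWord_mul_of_lt far l _ k (by omega) (by omega)]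
      simp only [mul_assoc]
    · rw [descWord, mul_assoc, far k (i + 1) (by omega) (by omega), ← mul_assoc,
        ih (k + 1) i hi (by omega) (by omega), mul_assoc]

/-- Coset decomposition `S_{m + 2} = ⋃ₖ S_{m + 1} * (s m * ⋯ * s k)`, valid in every group
generated by elements that satisfy the Coxeter relations of type `A`. -/
theorem exists_eq_mul_descWord (sq : ∀ i < N, s i * s i = 1)
    (far : ∀ i j, i + 1 < j → j < N → s i * s j = s j * s i)
    (braid : ∀ i, i + 1 < N → s i * s (i + 1) * s i = s (i + 1) * s i * s (i + 1))
    {m : ℕ} (hm : m < N) {g : G} (hg : g ∈ Subgroup.closure (s '' Set.Iio (m + 1))) :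
    ∃ h ∈ Subgroup.closure (s '' Set.Iio m), ∃ k l, k + l = m + 1 ∧ g = h * descWord s k l := by
  have step : ∀ x i, i < m + 1 →
      (∃ h ∈ Subgroup.closure (s '' Set.Iio m), ∃ k l, k + l = m + 1 ∧ x = h * descWord s k l) →
      ∃ h ∈ Subgroup.closure (s '' Set.Iio m), ∃ k l, k + l = m + 1 ∧
        x * s i = h * descWord s k l := by
    rintro _ i hi ⟨h, hh, k, l, hkl, rfl⟩
    have hs : ∀ j < m, s j ∈ Subgroup.closure (s '' Set.Iio m) := fun j hj =>
      Subgroup.subset_closure ⟨j, hj, rfl⟩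
    rcases lt_trichotomy (i + 1) k with hik | rfl | hik
    · refine ⟨h * s i, mul_mem hh (hs i (by omega)), k, l, hkl, ?_⟩
      rw [mul_assoc, descWord_mul_of_lt far l k i hik (by omega), mul_assoc]
    · exact ⟨h, hh, i, l + 1, by omega, by rw [descWord, mul_assoc]⟩
    · rcases (Nat.lt_succ_iff.1 hik).eq_or_lt with rfl | hki
      · obtain ⟨l, rfl⟩ : ∃ l', l = l' + 1 := ⟨l - 1, by omega⟩
        refine ⟨h, hh, k + 1, l, by omega, ?_⟩
        rw [descWord, mul_assoc, mul_assoc, sq k (by omega), mul_one]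
      · obtain ⟨i, rfl⟩ : ∃ i', i = i' + 1 := ⟨i - 1, by omega⟩
        refine ⟨h * s i, mul_mem hh (hs i (by omega)), k, l, hkl, ?_⟩
        rw [mul_assoc, descWord_mul_of_gt far braid l k i (by omega) (by omega) (by omega),
          mul_assoc]
  induction hg using Subgroup.closure_induction_right with
  | one => exact ⟨1, one_mem _, m + 1, 0, rfl, by simp [descWord]⟩
  | mul_right x hx y hy ih =>
    obtain ⟨i, hi, rfl⟩ := hy
    exact step x i hi ih
  | mul_inv_cancel x hx y hy ih =>
    obtain ⟨i, hi, rfl⟩ := hy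
    rw [inv_eq_of_mul_eq_one_right (sq i (lt_of_lt_of_le hi hm))]
    exact step x i hi ih

/-- The Coxeter relations of type `A` present the symmetric group: a homomorphism to permutations
that carries the generators to adjacent transpositions of the points `p i` is injective. -/
theorem eq_one_of_coxeter (sq : ∀ i < N, s i * s i = 1)
    (far : ∀ i j, i + 1 < j → j < N → s i * s j = s j * s i)
    (braid : ∀ i, i + 1 < N → s i * s (i + 1) * s i = s (i + 1) * s i * s (i + 1))
    {α : Type*} [DecidableEq α] {p : ℕ → α} (hp : Set.InjOn p (Set.Iic N))
    (ψ : G →* Equiv.Perm α) (hψ : ∀ i < N, ψ (s i) = Equiv.swap (p i) (p (i + 1)))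
    {m : ℕ} (hm : m ≤ N) {g : G} (hg : g ∈ Subgroup.closure (s '' Set.Iio m))
    (h1 : ψ g = 1) : g = 1 := by
  have word : ∀ l k, k + l ≤ N → ψ (descWord s k l) (p k) = p (k + l) := by
    intro l
    induction l with
    | zero => intro k _; simp [descWord]
    | succ l ih =>
      intro k hk
      rw [descWord, map_mul, Equiv.Perm.mul_apply, hψ k (by omega), Equiv.swap_apply_left,
        ih (k + 1) (by omega)]
      congr 1
      omega
  induction m generalizing g with
  | zero => simpa using hg
  | succ m ih =>
    obtain ⟨h, hh, k, l, hkl, rfl⟩ := exists_eq_mul_descWord sq far braid hm hg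
    have fix : ψ h (p (m + 1)) = p (m + 1) := by
      clear h1 hg
      induction hh using Subgroup.closure_induction with
      | one => simp
      | mem x hx =>
        obtain ⟨i, hi, rfl⟩ := hx
        have hi : i < m := hi
        rw [hψ i (by omega)]
        refine Equiv.swap_apply_of_ne_of_ne ?_ ?_ <;> intro h
        · have := hp (Set.mem_Iic.2 hm) (Set.mem_Iic.2 (by omega)) h
          omega
        · have := hp (Set.mem_Iic.2 hm) (Set.mem_Iic.2 (by omega)) h
          omega
      | mul x y _ _ hx hy => rw [map_mul, Equiv.Perm.mul_apply, hy, hx]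
      | inv x _ hx => rw [map_inv, Equiv.Perm.inv_eq_iff_eq, hx]
    have h2 := word l k (by omega)
    have h3 : p k = p (m + 1) := by
      have := congrArg (fun f : Equiv.Perm α => f (p k)) h1
      simpa [map_mul, Equiv.Perm.mul_apply, h2, hkl, fix] using this.symm
    have h4 := hp (Set.mem_Iic.2 (by omega)) (Set.mem_Iic.2 hm) h3
    obtain rfl : l = 0 := by omega
    simp only [descWord, mul_one] at h1 ⊢
    exact ih (by omega) hh h1

end Coxeter

/-! ### The spin group as a central extension -/

/-- The central element `z` of the spin group. -/
def spinZ (n : ℕ) : SpinGroup n := PresentedGroup.mk _ (fz n)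

/-- The generator `t i` of the spin group. -/
def spinT (i : Fin (n - 1)) : SpinGroup n := PresentedGroup.mk _ (ft i)

theorem spinZ_mul_self : spinZ n * spinZ n = 1 := by
  have h := PresentedGroup.one_of_mem (rels := {r | SpinRel n r}) (SpinRel.z_sq (n := n))
  rwa [map_pow, pow_two] at h

theorem spinT_mul_self (i : Fin (n - 1)) : spinT i * spinT i = spinZ n := by
  have h := PresentedGroup.one_of_mem (rels := {r | SpinRel n r}) (SpinRel.t_sq i)
  rw [map_mul, map_inv, mul_inv_eq_one, map_pow, pow_two] at h
  exact h

theorem spinT_braid {i j : Fin (n - 1)} (h : (j : ℕ) = i + 1) :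
    (spinT i * spinT j) ^ 3 = spinZ n := by
  have h := PresentedGroup.one_of_mem (rels := {r | SpinRel n r}) (SpinRel.braid i j h)
  rw [map_mul, map_inv, mul_inv_eq_one, map_pow, map_mul] at h
  exact h

theorem spinT_far {i j : Fin (n - 1)} (h : (j : ℕ) + 1 < i) :
    spinT i * spinT j = spinZ n * spinT j * spinT i := by
  have h := PresentedGroup.one_of_mem (rels := {r | SpinRel n r}) (SpinRel.far i j h)
  rw [map_mul, map_inv, mul_inv_eq_one, map_mul, map_mul, map_mul] at h
  exact h

theorem spinZ_comm_spinT (i : Fin (n - 1)) : spinZ n * spinT i = spinT i * spinZ n := by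
  have h := PresentedGroup.one_of_mem (rels := {r | SpinRel n r}) (SpinRel.comm i)
  rw [map_mul, map_inv, mul_inv_eq_one, map_mul, map_mul] at h
  exact h

theorem spinZ_comm (a : SpinGroup n) : spinZ n * a = a * spinZ n := by
  have h : a ∈ Subgroup.centralizer {spinZ n} := by
    refine PresentedGroup.generated_by _ _ ?_ a
    rintro (_ | i)
    · exact Subgroup.mem_centralizer_singleton_iff.2 rfl
    · exact Subgroup.mem_centralizer_singleton_iff.2 (spinZ_comm_spinT i).symm
  exact (Subgroup.mem_centralizer_singleton_iff.1 h).symm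

@[simp] theorem theta_spinZ : theta n (spinZ n) = 1 := PresentedGroup.toGroup.of _

@[simp] theorem theta_spinT (i : Fin (n - 1)) : theta n (spinT i) = adjSwap i :=
  PresentedGroup.toGroup.of _

theorem theta_surjective : Function.Surjective (theta n) := by
  rcases n with _ | n
  · intro σ
    exact ⟨1, Subsingleton.elim _ _⟩
  · rw [← MonoidHom.mrange_eq_top, eq_top_iff, ← Equiv.Perm.mclosure_swap_castSucc_succ,
      Submonoid.closure_le]
    rintro _ ⟨i, rfl⟩
    exact ⟨spinT (n := n + 1) i, theta_spinT (n := n + 1) i⟩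

theorem normal_zpowers_spinZ (n : ℕ) : (Subgroup.zpowers (spinZ n)).Normal := by
  refine ⟨fun a ha g => ?_⟩
  obtain ⟨k, rfl⟩ := ha
  have h : Commute g (spinZ n ^ k) := (Commute.zpow_right (spinZ_comm g).symm k)
  exact ⟨k, by simp [h.eq]⟩

/-- The kernel of the covering map is generated by `z`: modulo `z` the relations of the spin group
become the Coxeter relations. -/
theorem eq_one_or_eq_spinZ_of_theta_eq_one {a : SpinGroup n} (ha : theta n a = 1) :
    a = 1 ∨ a = spinZ n := by
  have key : a ∈ Subgroup.zpowers (spinZ n) := by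
    rcases n with _ | n
    · refine PresentedGroup.generated_by _ _ ?_ a
      rintro (_ | i)
      · exact Subgroup.mem_zpowers _
      · exact i.elim0
    · have := normal_zpowers_spinZ (n + 1)
      let π := QuotientGroup.mk' (Subgroup.zpowers (spinZ (n + 1)))
      have hz : π (spinZ (n + 1)) = 1 :=
        (QuotientGroup.eq_one_iff _).2 (Subgroup.mem_zpowers _)
      let s : ℕ → SpinGroup (n + 1) ⧸ Subgroup.zpowers (spinZ (n + 1)) := fun i =>
        if h : i < n then π (spinT ⟨i, h⟩) else 1
      have hs : ∀ i (h : i < n), s i = π (spinT ⟨i, h⟩) := fun i h => dif_pos h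
      let ψ : SpinGroup (n + 1) ⧸ Subgroup.zpowers (spinZ (n + 1)) →* Equiv.Perm (Fin (n + 1)) :=
        QuotientGroup.lift _ (theta (n + 1)) (by
          rw [Subgroup.zpowers_le]
          exact theta_spinZ)
      have sq : ∀ i < n, s i * s i = 1 := by
        intro i hi
        rw [hs i hi, ← map_mul, spinT_mul_self, hz]
      have hinv : ∀ i < n, (s i)⁻¹ = s i := fun i hi => inv_eq_of_mul_eq_one_right (sq i hi)
      have hgen : a ∈ (Subgroup.closure (s '' Set.Iio n)).comap π := by
        refine PresentedGroup.generated_by _ _ ?_ a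
        rintro (_ | i)
        · change π (spinZ (n + 1)) ∈ Subgroup.closure (s '' Set.Iio n)
          rw [hz]
          exact one_mem _
        · exact Subgroup.subset_closure ⟨i, i.2, hs i i.2⟩
      rw [← QuotientGroup.eq_one_iff]
      have hp : Set.InjOn (Fin.ofNat (n + 1)) (Set.Iic n) := by
        intro i hi j hj hij
        have := congrArg Fin.val hij
        simp only [Fin.val_ofNat] at this
        rwa [Nat.mod_eq_of_lt (Nat.lt_succ_of_le hi), Nat.mod_eq_of_lt (Nat.lt_succ_of_le hj)]
          at this
      refine eq_one_of_coxeter (N := n) (s := s) sq ?_ ?_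
        hp ψ ?_ le_rfl hgen ha
      · intro i j hij hj
        rw [hs i (by omega), hs j hj, ← map_mul π (spinT ⟨j, hj⟩),
          spinT_far (i := ⟨j, hj⟩) (j := ⟨i, by omega⟩) hij, map_mul, map_mul, hz, one_mul]
      · intro i hi
        have h3 : (s i * s (i + 1)) ^ 3 = 1 := by
          rw [hs i (by omega), hs _ hi, ← map_mul, ← map_pow, spinT_braid rfl, hz]
        rw [← mul_inv_eq_one, mul_inv_rev, mul_inv_rev, hinv i (by omega), hinv _ hi]
        simpa [pow_succ, mul_assoc] using h3
      · intro i hi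
        rw [hs i hi]
        change theta (n + 1) (spinT ⟨i, hi⟩) = _
        rw [theta_spinT, adjSwap]
        congr 1 <;> ext <;> simp [Nat.mod_eq_of_lt, hi, Nat.lt_succ_of_lt hi]
  obtain ⟨k, rfl⟩ := key
  rcases Int.even_or_odd k with hk | hk
  · left
    obtain ⟨j, rfl⟩ := hk
    simp [zpow_add, ← (Commute.refl (spinZ n)).mul_zpow, spinZ_mul_self]
  · right
    obtain ⟨j, rfl⟩ := hk
    simp [zpow_add, two_mul, ← (Commute.refl (spinZ n)).mul_zpow, spinZ_mul_self]

/-! ### Nontriviality of `z` -/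

/-- The quadratic form `-½ ∑ vᵢ²`; the roots `eᵢ - eⱼ` have value `-1`. -/
def spinForm (n : ℕ) : QuadraticForm ℚ (Fin n → ℚ) :=
  QuadraticMap.weightedSumSquares ℚ fun _ => (-(1 / 2) : ℚ)

theorem spinForm_apply (v : Fin n → ℚ) : spinForm n v = -(1 / 2) * (v ⬝ᵥ v) := by
  simp [spinForm, dotProduct, Finset.mul_sum]

theorem polar_spinForm (u v : Fin n → ℚ) : QuadraticMap.polar (spinForm n) u v = -(u ⬝ᵥ v) := by
  simp only [QuadraticMap.polar, spinForm_apply, add_dotProduct, dotProduct_add,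
    dotProduct_comm v u]
  ring

/-- The simple root `eᵢ - eᵢ₊₁`. -/
def spinRoot (i : Fin (n - 1)) : Fin n → ℚ :=
  Pi.single ⟨i, by omega⟩ 1 - Pi.single ⟨i + 1, by omega⟩ 1

theorem spinForm_spinRoot (i : Fin (n - 1)) : spinForm n (spinRoot i) = -1 := by
  simp only [spinForm_apply, spinRoot, dotProduct_sub, dotProduct_single_one, Pi.sub_apply]
  rw [Pi.single_eq_same, Pi.single_eq_same, Pi.single_eq_of_ne, Pi.single_eq_of_ne]
  · norm_num
  all_goals simp only [ne_eq, Fin.ext_iff]; omega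

theorem polar_spinRoot_adjacent {i j : Fin (n - 1)} (h : (j : ℕ) = i + 1) :
    QuadraticMap.polar (spinForm n) (spinRoot i) (spinRoot j) = 1 := by
  simp only [polar_spinForm, spinRoot, sub_dotProduct, single_one_dotProduct, Pi.sub_apply, h]
  rw [Pi.single_eq_same, Pi.single_eq_of_ne, Pi.single_eq_of_ne, Pi.single_eq_of_ne]
  · norm_num
  all_goals simp only [ne_eq, Fin.ext_iff]; omega

theorem polar_spinRoot_far {i j : Fin (n - 1)} (h : (j : ℕ) + 1 < i) :
    QuadraticMap.polar (spinForm n) (spinRoot i) (spinRoot j) = 0 := by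
  simp only [polar_spinForm, spinRoot, sub_dotProduct, single_one_dotProduct, Pi.sub_apply]
  rw [Pi.single_eq_of_ne, Pi.single_eq_of_ne, Pi.single_eq_of_ne, Pi.single_eq_of_ne]
  · simp
  all_goals simp only [ne_eq, Fin.ext_iff]; omega

theorem ι_spinRoot_mul_self (i : Fin (n - 1)) :
    CliffordAlgebra.ι (spinForm n) (spinRoot i) * CliffordAlgebra.ι (spinForm n) (spinRoot i) =
      -1 := by
  rw [CliffordAlgebra.ι_sq_scalar, spinForm_spinRoot, map_neg, map_one]

/-- The spin representation on the generators: `z ↦ -1`, and `t i` goes to the simple root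
`eᵢ - eᵢ₊₁`. -/
def spinRepGen (n : ℕ) : SpinGen n → (CliffordAlgebra (spinForm n))ˣ
  | SpinGen.z => -1
  | SpinGen.t i =>
    ⟨CliffordAlgebra.ι (spinForm n) (spinRoot i), -CliffordAlgebra.ι (spinForm n) (spinRoot i),
      by rw [mul_neg, ι_spinRoot_mul_self, neg_neg], by rw [neg_mul, ι_spinRoot_mul_self, neg_neg]⟩

theorem spinRepGen_rel (n : ℕ) :
    ∀ r ∈ {r | SpinRel n r}, FreeGroup.lift (spinRepGen n) r = 1 := by
  rintro r (_ | i | ⟨i, j, h⟩ | ⟨i, j, h⟩ | i)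
  · simp [fz, spinRepGen]
  · simp only [fz, ft, map_mul, map_pow, map_inv, FreeGroup.lift_apply_of, mul_inv_eq_one]
    ext
    rw [pow_two]
    exact ι_spinRoot_mul_self i
  · simp only [fz, ft, map_mul, map_pow, map_inv, FreeGroup.lift_apply_of, mul_inv_eq_one]
    ext
    simp only [spinRepGen, Units.val_pow_eq_pow_val, Units.val_mul, Units.val_neg, Units.val_one]
    have hu := ι_spinRoot_mul_self i
    have hv := ι_spinRoot_mul_self j
    have huv := CliffordAlgebra.ι_mul_ι_add_swap (Q := spinForm n) (spinRoot i) (spinRoot j)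
    rw [polar_spinRoot_adjacent h, map_one] at huv
    generalize CliffordAlgebra.ι (spinForm n) (spinRoot i) = u at *
    generalize CliffordAlgebra.ι (spinForm n) (spinRoot j) = v at *
    -- `a = u * v` has inverse `v * u = 1 - a`, hence is a primitive sixth root of unity
    have ha : u * v * (v * u) = 1 := by
      rw [mul_assoc, ← mul_assoc v, hv, neg_one_mul, mul_neg, hu, neg_neg]
    rw [eq_sub_of_add_eq' huv] at ha
    generalize u * v = a at *
    have ha2 : a * a = a - 1 := by
      rw [mul_sub, mul_one] at ha
      rw [← ha]
      abel
    rw [pow_succ, pow_two, ha2, sub_mul, ha2]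
    noncomm_ring
  · simp only [fz, ft, map_mul, map_inv, FreeGroup.lift_apply_of, mul_inv_eq_one]
    ext
    have huv := CliffordAlgebra.ι_mul_ι_add_swap (Q := spinForm n) (spinRoot i) (spinRoot j)
    rw [polar_spinRoot_far h, map_zero] at huv
    simpa [spinRepGen] using eq_neg_of_add_eq_zero_left huv
  · simp only [fz, ft, map_mul, map_inv, FreeGroup.lift_apply_of, mul_inv_eq_one, spinRepGen]
    rw [neg_one_mul, mul_neg_one]

/-- `z` acts as `-1` on the Clifford algebra, where `2 ≠ 0`. -/
theorem spinZ_ne_one (n : ℕ) : spinZ n ≠ 1 := by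
  intro h
  have h1 : PresentedGroup.toGroup (spinRepGen_rel n) (spinZ n) = -1 := PresentedGroup.toGroup.of _
  rw [h, map_one, eq_comm, Units.ext_iff, Units.val_neg, Units.val_one] at h1
  have h2 : (1 + 1 : CliffordAlgebra (spinForm n)) = 0 := by
    nth_rewrite 1 [← h1]
    exact neg_add_cancel _
  have h3 : algebraMap ℚ (CliffordAlgebra (spinForm n)) 2 = 0 := by
    rw [← h2, ← one_add_one_eq_two, map_add, map_one]
  have : Nontrivial (CliffordAlgebra (spinForm n)) :=
    have : Invertible (2 : ℚ) := invertibleOfNonzero two_ne_zero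
    inferInstance
  exact two_ne_zero ((map_eq_zero _).1 h3)

theorem theta_spinZ_mul (a : SpinGroup n) : theta n (spinZ n * a) = theta n a := by
  rw [map_mul, theta_spinZ, one_mul]

theorem eq_or_eq_spinZ_mul {a b : SpinGroup n} (h : theta n a = theta n b) :
    a = b ∨ a = spinZ n * b := by
  rcases eq_one_or_eq_spinZ_of_theta_eq_one (a := a * b⁻¹) (by simp [h]) with h | h
  · exact Or.inl (mul_inv_eq_one.1 h)
  · exact Or.inr (mul_inv_eq_iff_eq_mul.1 h)

/-- The relation `a * b = c * b * a`, with `c` central, depends only on the permutations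
under `a` and `b`. -/
theorem mul_eq_mul_mul_congr {a a' b b' c : SpinGroup n} (ha : theta n a = theta n a')
    (hb : theta n b = theta n b') (h : a * b = c * (b * a)) : a' * b' = c * (b' * a') := by
  have z1 : ∀ u v : SpinGroup n, u * v = c * (v * u) →
      (spinZ n * u) * v = c * (v * (spinZ n * u)) := by
    intro u v huv
    rw [mul_assoc, huv, ← mul_assoc v, ← spinZ_comm v, mul_assoc, ← mul_assoc, ← mul_assoc c,
      spinZ_comm c]
  have z2 : ∀ u v : SpinGroup n, u * v = c * (v * u) →
      u * (spinZ n * v) = c * ((spinZ n * v) * u) := by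
    intro u v huv
    rw [← mul_assoc u, ← spinZ_comm u, mul_assoc, huv, ← mul_assoc, spinZ_comm c]
    simp only [mul_assoc]
  rcases eq_or_eq_spinZ_mul ha.symm with rfl | rfl <;>
  rcases eq_or_eq_spinZ_mul hb.symm with rfl | rfl
  · exact h
  · exact z2 _ _ h
  · exact z1 _ _ h
  · exact z1 _ _ (z2 _ _ h)

theorem mul_comm_or_eq_spinZ_mul {a b : SpinGroup n}
    (h : theta n a * theta n b = theta n b * theta n a) :
    a * b = b * a ∨ a * b = spinZ n * (b * a) :=
  eq_or_eq_spinZ_mul (by simpa using h)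

theorem ne_spinZ_mul_self (a : SpinGroup n) : a ≠ spinZ n * a := fun h =>
  spinZ_ne_one n (mul_eq_right.1 h.symm)

/-! ### Lifts of disjoint permutations -/

/-- The Koszul sign as an element of the spin group: `z` if both arguments are `-1`, and `1`
otherwise. -/
def koszul (n : ℕ) (u v : ℤˣ) : SpinGroup n := if u = -1 ∧ v = -1 then spinZ n else 1

@[simp] theorem koszul_one_left (v : ℤˣ) : koszul n 1 v = 1 := by simp [koszul]

@[simp] theorem koszul_one_right (v : ℤˣ) : koszul n v 1 = 1 := by simp [koszul]

@[simp] theorem koszul_neg_one : koszul n (-1) (-1) = spinZ n := by simp [koszul]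

theorem koszul_mul_self (u v : ℤˣ) : koszul n u v * koszul n u v = 1 := by
  unfold koszul
  split_ifs
  · exact spinZ_mul_self
  · simp

theorem koszul_swap (u v : ℤˣ) : koszul n u v = koszul n v u := by
  simp [koszul, and_comm]

theorem koszul_neg_left (u v : ℤˣ) : koszul n (-1 * u) v = koszul n (-1) v * koszul n u v := by
  rcases Int.units_eq_one_or u with rfl | rfl <;> rcases Int.units_eq_one_or v with rfl | rfl <;>
    simp [spinZ_mul_self]

theorem koszul_comm (u v : ℤˣ) (a : SpinGroup n) : koszul n u v * a = a * koszul n u v := by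
  unfold koszul
  split_ifs
  · exact spinZ_comm a
  · simp

/-- Two disjoint transpositions are simultaneously conjugate to those under `t 0` and `t 2`. -/
theorem mul_eq_spinZ_mul_of_swaps {a b : SpinGroup n} {i j k l : Fin n}
    (hd : [i, j, k, l].Nodup) (ha : theta n a = Equiv.swap i j) (hb : theta n b = Equiv.swap k l) :
    a * b = spinZ n * (b * a) := by
  have hinj : Function.Injective ![i, j, k, l] := 
    List.nodup_ofFn.1 (by simpa [List.ofFn_succ] using hd)
  have hn : 4 ≤ n := by simpa using Fintype.card_le_of_injective _ hinj
  obtain ⟨π, hπ⟩ := (Equiv.Perm.isMultiplyPretransitive (Fin n) 4).exists_smul_eq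
    (Fin.castLEEmb hn) ⟨_, hinj⟩
  obtain ⟨p, rfl⟩ := theta_surjective π
  have hπ' : ∀ q : Fin 4, theta n p (Fin.castLE hn q) = ![i, j, k, l] q := fun q =>
    DFunLike.congr_fun hπ q
  have hconj : ∀ (m : Fin (n - 1)) (q r : Fin 4), (q : ℕ) = m → (r : ℕ) = m + 1 →
      theta n (p * spinT m * p⁻¹) = Equiv.swap (![i, j, k, l] q) (![i, j, k, l] r) := by
    intro m q r hq hr
    rw [← hπ', ← hπ', Equiv.swap_apply_apply, map_mul, map_mul, map_inv, theta_spinT, adjSwap]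
    congr 4 <;> simp [hq, hr]
  have h0 := hconj ⟨0, by omega⟩ 0 1 rfl rfl
  have h2 := hconj ⟨2, by omega⟩ 2 3 rfl rfl
  have hfar := spinT_far (n := n) (i := ⟨2, by omega⟩) (j := ⟨0, by omega⟩) (by simp)
  have hba := mul_eq_mul_mul_congr (h2.trans hb.symm) (h0.trans ha.symm) (c := spinZ n) <| by
    rw [conj_mul, conj_mul, hfar, ← mul_assoc, ← mul_assoc, ← spinZ_comm p]
    simp only [mul_assoc]
  rw [hba, ← mul_assoc, spinZ_mul_self, one_mul]

/-- The commutation rule with a fixed `b` extends from transpositions to all permutations disjoint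
from that of `b`: every such permutation is a product of transpositions inside its support. -/
theorem mul_eq_koszul_of_swaps {b : SpinGroup n}
    (H : ∀ (s : SpinGroup n) (i j : Fin n), i ≠ j → theta n s = Equiv.swap i j →
      (theta n s).Disjoint (theta n b) →
      s * b = koszul n (-1) (Equiv.Perm.sign (theta n b)) * (b * s)) :
    ∀ (m : ℕ) (a : SpinGroup n), (theta n a).support.card = m → (theta n a).Disjoint (theta n b) →
      a * b = koszul n (Equiv.Perm.sign (theta n a)) (Equiv.Perm.sign (theta n b)) * (b * a) := by
  intro m
  induction m using Nat.strong_induction_on with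
  | _ m ih =>
    intro a hm hd
    by_cases h1 : theta n a = 1
    · rw [h1, map_one, koszul_one_left, one_mul]
      rcases eq_one_or_eq_spinZ_of_theta_eq_one h1 with rfl | rfl
      · simp
      · exact spinZ_comm b
    · obtain ⟨i, hi⟩ : ∃ i, theta n a i ≠ i := by
        by_contra! h
        exact h1 (Equiv.ext h)
      obtain ⟨s, hs⟩ := theta_surjective (Equiv.swap i (theta n a i))
      obtain ⟨a, rfl⟩ : ∃ a', a = s * a' := ⟨s⁻¹ * a, by group⟩
      have hs1 : theta n s * theta n s = 1 := by rw [hs, Equiv.swap_mul_self]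
      have hθ : theta n a = Equiv.swap i (theta n (s * a) i) * theta n (s * a) := by
        rw [← hs, map_mul, ← mul_assoc, hs1, one_mul]
      have hlt : (theta n a).support.card < m := by
        rw [hθ, ← hm]
        exact Equiv.Perm.card_support_swap_mul hi
      have hds : (theta n s).Disjoint (theta n b) := by
        intro k
        rcases hd k with hk | hk
        · left
          rw [hs]
          refine Equiv.swap_apply_of_ne_of_ne ?_ ?_
          · rintro rfl
            exact hi hk
          · intro h
            rw [h] at hk
            exact hi ((theta n (s * a)).injective hk)
        · exact Or.inr hk
      have hda : (theta n a).Disjoint (theta n b) := by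
        have : theta n a = theta n s * theta n (s * a) := by rw [hθ, hs]
        rw [this]
        exact hds.mul_left hd
      have h2 := ih _ hlt a rfl hda
      have h3 := H s i _ (Ne.symm hi) hs hds
      rw [map_mul, map_mul, hs, Equiv.Perm.sign_swap (Ne.symm hi), koszul_neg_left, mul_assoc, h2,
        ← mul_assoc s, ← koszul_comm _ _ s, mul_assoc, ← mul_assoc s, h3]
      simp only [← mul_assoc]
      rw [koszul_comm (-1)]

/-- Lifts of disjoint permutations commute up to the Koszul sign of their parities. -/
theorem mul_eq_koszul_mul_of_disjoint {a b : SpinGroup n} (hd : (theta n a).Disjoint (theta n b)) :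
    a * b =
      koszul n (Equiv.Perm.sign (theta n a)) (Equiv.Perm.sign (theta n b)) * (b * a) := by
  have flip : ∀ {u v c : SpinGroup n}, c * c = 1 → u * v = c * (v * u) → v * u = c * (u * v) := by
    intro u v c hc h
    rw [h, ← mul_assoc, hc, one_mul]
  refine mul_eq_koszul_of_swaps (fun s i j hij hs hsb => ?_) _ a rfl hd
  rw [koszul_swap]
  refine flip (koszul_mul_self _ _) ?_
  have h1 : Equiv.Perm.sign (theta n s) = -1 := by rw [hs, Equiv.Perm.sign_swap hij]
  rw [← h1]
  refine mul_eq_koszul_of_swaps (fun t k l hkl ht hts => ?_) _ b rfl hsb.symm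
  rw [h1, koszul_neg_one]
  refine mul_eq_spinZ_mul_of_swaps ?_ ht hs
  have hk : k ∉ (theta n s).support := Finset.disjoint_left.1
    (Equiv.Perm.disjoint_iff_disjoint_support.1 hts) (by simp [ht, hkl.symm])
  have hl : l ∉ (theta n s).support := Finset.disjoint_left.1
    (Equiv.Perm.disjoint_iff_disjoint_support.1 hts) (by simp [ht, hkl])
  rw [hs, Equiv.Perm.support_swap hij] at hk hl
  simp only [Finset.mem_insert, Finset.mem_singleton, not_or] at hk hl
  simp [hkl, hij, hk, hl]

/-! ### The splitting criterion -/

/-- For a central extension with kernel `{1, ζ}`, the preimage of a class splits if and only if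
`x` and `ζ * x` are not conjugate. -/
theorem splitsIntoTwo_iff_not_isConj {G H : Type*} [Group G] [Group H] (f : G →* H)
    (hf : Function.Surjective f) {ζ : G} (hζ : ∀ a, ζ * a = a * ζ) (hfζ : f ζ = 1)
    (hker : ∀ a, f a = 1 → a = 1 ∨ a = ζ) (x : G) :
    SplitsIntoTwo (f ⁻¹' (ConjClasses.mk (f x)).carrier) ↔ ¬IsConj x (ζ * x) := by
  have hpre : f ⁻¹' (ConjClasses.mk (f x)).carrier =
      (ConjClasses.mk x).carrier ∪ (ConjClasses.mk (ζ * x)).carrier := by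
    ext y
    simp only [Set.mem_preimage, Set.mem_union, ConjClasses.mem_carrier_iff_mk_eq,
      ConjClasses.mk_eq_mk_iff_isConj]
    constructor
    · intro h
      obtain ⟨w, hw⟩ := isConj_iff.1 h.symm
      obtain ⟨w, rfl⟩ := hf w
      rcases hker (y * (w * x * w⁻¹)⁻¹) (by
        rw [map_mul, map_inv, map_mul, map_mul, map_inv, hw, mul_inv_cancel]) with h | h
      · exact Or.inl (isConj_iff.2 ⟨w, (mul_inv_eq_one.1 h).symm⟩).symm
      · refine Or.inr (isConj_iff.2 ⟨w, ?_⟩).symm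
        rw [mul_inv_eq_iff_eq_mul.1 h, ← mul_assoc w, ← hζ w]
        simp only [mul_assoc]
    · rintro (h | h)
      · exact f.map_isConj h
      · simpa [hfζ] using f.map_isConj h
  rw [hpre]
  constructor
  · rintro ⟨D₁, D₂, hne, h⟩ hc
    rw [← ConjClasses.mk_eq_mk_iff_isConj.2 hc, Set.union_self] at h
    have key : ∀ D : ConjClasses G, D.carrier ⊆ (ConjClasses.mk x).carrier →
        D = ConjClasses.mk x := by
      intro D hD
      induction D using Quotient.inductionOn with
      | _ d => exact ConjClasses.mem_carrier_iff_mk_eq.1 (hD ConjClasses.mem_carrier_mk)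
    exact hne ((key D₁ (h ▸ Set.subset_union_left)).trans
      (key D₂ (h ▸ Set.subset_union_right)).symm)
  · intro h
    exact ⟨_, _, fun h' => h (ConjClasses.mk_eq_mk_iff_isConj.1 h'), rfl⟩

theorem wreathTheta_left (x : SpinWreathProd Γ n) : (wreathTheta Γ n x).left = x.left := rfl

/-- The preimage of the class of `x` splits if and only if the lifts of `w.right` and `x.right` to
the spin group commute for every `w` that commutes with `x`. -/
theorem splitsIntoTwo_iff (x : Wreath Γ n) :
    SplitsIntoTwo (wreathTheta Γ n ⁻¹' (ConjClasses.mk x).carrier) ↔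
      ∀ w : Wreath Γ n, w * x = x * w → ∀ a b : SpinGroup n,
        theta n a = w.right → theta n b = x.right → a * b = b * a := by
  obtain ⟨x, rfl⟩ : ∃ y, wreathTheta Γ n y = x := by
    obtain ⟨b, hb⟩ := theta_surjective x.right
    exact ⟨⟨x.left, b⟩, SemidirectProduct.ext rfl hb⟩
  let ζ : SpinWreathProd Γ n := SemidirectProduct.inr (spinZ n)
  have hζ_left : ∀ a : SpinWreathProd Γ n, (ζ * a).left = a.left := by
    intro a
    simp only [ζ, SemidirectProduct.mul_left, SemidirectProduct.left_inr,
      SemidirectProduct.right_inr, MonoidHom.comp_apply, theta_spinZ, map_one, one_mul]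
    rfl
  have hζ_right : ∀ a : SpinWreathProd Γ n, (ζ * a).right = spinZ n * a.right := fun a => rfl
  rw [splitsIntoTwo_iff_not_isConj (wreathTheta Γ n) (ζ := ζ)]
  rotate_left
  · intro w
    obtain ⟨b, hb⟩ := theta_surjective w.right
    exact ⟨⟨w.left, b⟩, SemidirectProduct.ext rfl hb⟩
  · intro a
    refine SemidirectProduct.ext ?_ (spinZ_comm a.right)
    rw [hζ_left]
    simp [ζ]
  · exact SemidirectProduct.ext rfl theta_spinZ
  · intro a ha
    have hl : a.left = 1 := congrArg SemidirectProduct.left ha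
    rcases eq_one_or_eq_spinZ_of_theta_eq_one (congrArg SemidirectProduct.right ha) with h | h
    · exact Or.inl (SemidirectProduct.ext hl h)
    · exact Or.inr (SemidirectProduct.ext hl h)
  constructor
  · intro hconj w hw a b ha hb
    by_contra hne
    have hθ : theta n a * theta n b = theta n b * theta n a := by
      rw [ha, hb]
      exact congrArg SemidirectProduct.right hw
    have hab := (mul_comm_or_eq_spinZ_mul hθ).resolve_left hne
    refine hconj (isConj_iff.2 ⟨⟨w.left, a⟩, mul_inv_eq_iff_eq_mul.2 ?_⟩)
    have hlift : wreathTheta Γ n ⟨w.left, a⟩ = w := SemidirectProduct.ext rfl ha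
    refine SemidirectProduct.ext ?_ ?_
    · rw [mul_assoc, hζ_left, ← wreathTheta_left, ← wreathTheta_left, map_mul, map_mul, hlift, hw]
    · have h2 := mul_eq_mul_mul_congr (a' := a) (b' := x.right) rfl hb hab
      rw [mul_assoc]
      exact h2
  · intro H hconj
    obtain ⟨w, hw⟩ := isConj_iff.1 hconj
    rw [mul_inv_eq_iff_eq_mul, mul_assoc] at hw
    have hl : wreathTheta Γ n w * wreathTheta Γ n x = wreathTheta Γ n x * wreathTheta Γ n w := by
      rw [← map_mul, hw, ← map_mul]
      exact SemidirectProduct.ext (hζ_left _) (theta_spinZ_mul _)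
    have h1 := H _ hl w.right x.right rfl rfl
    have h2 : w.right * x.right = spinZ n * (x.right * w.right) :=
      congrArg SemidirectProduct.right hw
    exact ne_spinZ_mul_self _ (h1.symm.trans h2)

/-! ### Cycles and parity -/

theorem disjoint_mul_inv_cycleOf (σ : Equiv.Perm (Fin n)) (i : Fin n) :
    (σ * (σ.cycleOf i)⁻¹).Disjoint (σ.cycleOf i) := by
  by_cases h : σ i = i
  · rw [(Equiv.Perm.cycleOf_eq_one_iff σ).2 h]
    exact Equiv.Perm.disjoint_one_right _
  · exact Equiv.Perm.disjoint_mul_inv_of_mem_cycleFactorsFinset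
      (Equiv.Perm.cycleOf_mem_cycleFactorsFinset_iff.2 (Equiv.Perm.mem_support.2 h))

/-- How the lift of a cycle of `σ` commutes with the lift of `σ`. -/
theorem mul_eq_koszul_mul_of_cycleOf {b e : SpinGroup n} {i : Fin n}
    (he : theta n e = (theta n b).cycleOf i) :
    e * b = koszul n (Equiv.Perm.sign (theta n e))
      (Equiv.Perm.sign (theta n b) * Equiv.Perm.sign (theta n e)) * (b * e) := by
  obtain ⟨r, rfl⟩ : ∃ r, b = r * e := ⟨b * e⁻¹, by group⟩
  have hr : theta n r = theta n (r * e) * (theta n e)⁻¹ := by simp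
  have hd : (theta n e).Disjoint (theta n r) := by
    rw [hr, he]
    exact (disjoint_mul_inv_cycleOf _ i).symm
  rw [map_mul, map_mul, mul_assoc, Int.units_mul_self, mul_one, ← mul_assoc e,
    mul_eq_koszul_mul_of_disjoint hd]
  simp only [mul_assoc]

/-- If `a * b * a⁻¹ = z * b` and `θ b` has odd order `m`, then comparing `m`-th powers of the two
sides would give `b ^ m = z * b ^ m`, as `b ^ m` is central. -/
theorem mul_comm_of_odd_pow_eq_one {a b : SpinGroup n}
    (h : theta n a * theta n b = theta n b * theta n a) {m : ℕ} (hm : Odd m)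
    (hb : theta n b ^ m = 1) : a * b = b * a := by
  refine (mul_comm_or_eq_spinZ_mul h).resolve_right fun hab => ?_
  have hc : a * b ^ m = b ^ m * a := by
    rw [← map_pow] at hb
    rcases eq_one_or_eq_spinZ_of_theta_eq_one hb with h | h <;> rw [h]
    · simp
    · exact (spinZ_comm a).symm
  have h1 : a * b * a⁻¹ = spinZ n * b := by rw [hab]; group
  have h2 := congrArg (· ^ m) h1
  have hz : spinZ n ^ m = spinZ n := by
    obtain ⟨k, rfl⟩ := hm
    rw [pow_succ, pow_mul, pow_two, spinZ_mul_self, one_pow, one_mul]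
  have hcomm : Commute (spinZ n) b := spinZ_comm b
  simp only [conj_pow, hcomm.mul_pow, hc, mul_inv_cancel_right, hz] at h2
  exact ne_spinZ_mul_self _ h2

theorem exists_odd_pow_eq_one {σ : Equiv.Perm (Fin n)}
    (h : ∀ i, Odd (Function.minimalPeriod σ i)) : ∃ m, Odd m ∧ σ ^ m = 1 := by
  refine ⟨∏ i, Function.minimalPeriod σ i, ?_, ?_⟩
  · exact Finset.prod_induction _ Odd (fun _ _ => Odd.mul) odd_one fun i _ => h i
  · ext i
    rw [Equiv.Perm.coe_pow]
    have : Function.IsPeriodicPt σ (∏ i, Function.minimalPeriod σ i) i :=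
      (Function.isPeriodicPt_minimalPeriod σ i).trans_dvd
        (Finset.dvd_prod_of_mem _ (Finset.mem_univ i))
    exact congrArg Fin.val this

/-- If `σ` is odd, then every permutation that commutes with `σ` and maps each cycle of `σ` to
itself has a lift commuting with the lift of `σ`: it is a product of powers of cycles `c` of `σ`,
and `sign c` and `sign (σ * c⁻¹)` are not both `-1`. -/
theorem mul_comm_of_sameCycle {b : SpinGroup n} (hb : Equiv.Perm.sign (theta n b) = -1) :
    ∀ (m : ℕ) (a : SpinGroup n), (theta n a).support.card = m →
      theta n a * theta n b = theta n b * theta n a →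
      (∀ i, (theta n b).SameCycle i (theta n a i)) → a * b = b * a := by
  intro m
  induction m using Nat.strong_induction_on with
  | _ m ih =>
    intro a hm hab hs
    by_cases h1 : theta n a = 1
    · rcases eq_one_or_eq_spinZ_of_theta_eq_one h1 with rfl | rfl
      · simp
      · exact spinZ_comm b
    obtain ⟨i, hi⟩ : ∃ i, theta n a i ≠ i := by
      by_contra! h
      exact h1 (Equiv.ext h)
    obtain ⟨k, hk⟩ := hs i
    obtain ⟨e, he⟩ := theta_surjective ((theta n b).cycleOf i)
    have heb : Commute e b := by
      have h := mul_eq_koszul_mul_of_cycleOf he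
      rw [hb] at h
      refine h.trans ?_
      rcases Int.units_eq_one_or (Equiv.Perm.sign (theta n e)) with hu | hu <;> rw [hu] <;> simp
    -- strip off the power of the cycle through `i`; what is left fixes that cycle pointwise
    obtain ⟨a, rfl⟩ : ∃ a', a = e ^ k * a' := ⟨(e ^ k)⁻¹ * a, by group⟩
    have hθ : theta n a = ((theta n b).cycleOf i ^ k)⁻¹ * theta n (e ^ k * a) := by
      simp [he]
    have hcomm : ∀ j, (theta n b).SameCycle i j →
        theta n (e ^ k * a) j = ((theta n b).cycleOf i ^ k) j := by
      rintro j ⟨l, rfl⟩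
      rw [Equiv.Perm.SameCycle.cycleOf_eq (f := theta n b) (x := i) (y := (theta n b ^ l) i)
        ⟨l, rfl⟩, Equiv.Perm.cycleOf_zpow_apply_self]
      have hc : Commute (theta n (e ^ k * a)) (theta n b ^ l) := Commute.zpow_right hab l
      rw [← Equiv.Perm.mul_apply, hc.eq, Equiv.Perm.mul_apply, ← hk,
        ← Equiv.Perm.mul_apply, ← Equiv.Perm.mul_apply, ← zpow_add, ← zpow_add, add_comm]
    have hfix : ∀ j, (theta n b).SameCycle i j → theta n a j = j := by
      intro j hj
      rw [hθ, Equiv.Perm.mul_apply, hcomm j hj, Equiv.Perm.inv_eq_iff_eq]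
    have hoff : ∀ j, ¬(theta n b).SameCycle i j → theta n a j = theta n (e ^ k * a) j := by
      intro j hj
      rw [hθ, Equiv.Perm.mul_apply, Equiv.Perm.inv_eq_iff_eq, eq_comm]
      refine Equiv.Perm.zpow_apply_eq_self_of_apply_eq_self
        (Equiv.Perm.cycleOf_apply_of_not_sameCycle fun h => hj (h.trans (hs j).symm)) k
    have hlt : (theta n a).support.card < m := by
      rw [← hm]
      refine Finset.card_lt_card ⟨fun j hj => ?_, fun h => ?_⟩
      · rw [Equiv.Perm.mem_support] at hj ⊢
        by_cases hij : (theta n b).SameCycle i j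
        · exact absurd (hfix j hij) hj
        · rwa [← hoff j hij]
      · exact Equiv.Perm.mem_support.1 (h (Equiv.Perm.mem_support.2 hi))
          (hfix i (Equiv.Perm.SameCycle.refl _ _))
    have heb' : Commute (e ^ k) b := heb.zpow_left k
    have hθc : theta n a * theta n b = theta n b * theta n a := by
      have h1 : Commute (theta n (e ^ k)) (theta n b) := heb'.map (theta n)
      have h2 : Commute (theta n (e ^ k * a)) (theta n b) := hab
      have h3 : theta n a = (theta n (e ^ k))⁻¹ * theta n (e ^ k * a) := by simp
      rw [h3]
      exact (h1.inv_left.mul_left h2).eq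
    have hs' : ∀ j, (theta n b).SameCycle j (theta n a j) := by
      intro j
      by_cases hij : (theta n b).SameCycle i j
      · rw [hfix j hij]
      · rw [hoff j hij]
        exact hs j
    have h2 : Commute a b := ih _ hlt a rfl hθc hs'
    exact (heb'.mul_left h2).eq

theorem minimalPeriod_eq_card (σ : Equiv.Perm (Fin n)) (i : Fin n) :
    Function.minimalPeriod σ i = (Finset.univ.filter fun j => σ.SameCycle i j).card := by
  classical
  have h := cycleLength_eq_card (Γ := Unit) ⟨1, σ⟩ (Quotient.mk _ i)
  refine Eq.trans h ?_
  rw [Nat.card_eq_fintype_card, Fintype.card_subtype]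
  congr 1
  ext j
  simp only [Finset.mem_filter, Finset.mem_univ, true_and, Quotient.eq]
  exact Equiv.Perm.sameCycle_comm

theorem sign_cycleOf (σ : Equiv.Perm (Fin n)) (i : Fin n) :
    Equiv.Perm.sign (σ.cycleOf i) = (-1) ^ (Function.minimalPeriod σ i + 1) := by
  by_cases h : σ i = i
  · rw [(Equiv.Perm.cycleOf_eq_one_iff σ).2 h,
      Function.minimalPeriod_eq_one_iff_isFixedPt.2 h]
    simp
  · rw [(Equiv.Perm.isCycle_cycleOf σ h).sign, minimalPeriod_eq_card, pow_succ, mul_neg_one]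
    congr 3
    ext j
    simp [Equiv.Perm.mem_support_cycleOf_iff' h]

/-- The sign of a permutation is the product of the signs of its cycles. -/
theorem sign_eq_prod_cycleLength (x : Wreath Γ n) [Fintype (Cycles x.right)] :
    Equiv.Perm.sign x.right = ∏ y, (-1) ^ (cycleLength x y + 1) := by
  let K : Cycles x.right → Equiv.Perm (Fin n) :=
    Quotient.lift (fun i => x.right.cycleOf i) fun _ _ h => Equiv.Perm.SameCycle.cycleOf_eq h
  have hK : ∀ y, Equiv.Perm.sign (K y) = (-1) ^ (cycleLength x y + 1) := by
    intro y
    induction y using Quotient.inductionOn with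
    | _ i => exact sign_cycleOf x.right i
  have hmove : ∀ i, Equiv.Perm.sign (x.right.cycleOf i) ≠ 1 → x.right i ≠ i := by
    intro i hi h
    rw [(Equiv.Perm.cycleOf_eq_one_iff _).2 h, map_one] at hi
    exact hi rfl
  simp_rw [← hK]
  have h1 : Equiv.Perm.sign x.right = ∏ c ∈ x.right.cycleFactorsFinset, Equiv.Perm.sign c := by
    rw [Equiv.Perm.sign_of_cycleType', Equiv.Perm.cycleType, Multiset.map_map, Finset.prod]
    refine congrArg _ (Multiset.map_congr rfl fun c hc => ?_)
    exact ((Equiv.Perm.mem_cycleFactorsFinset_iff.1 hc).1.sign).symm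
  rw [h1]
  symm
  -- fixed points give the factor `1` and have no counterpart among the cycle factors
  refine Finset.prod_bij_ne_one (fun y _ _ => K y) ?_ ?_ ?_ fun _ _ _ => rfl
  · intro y _ hy
    induction y using Quotient.inductionOn with
    | _ i =>
      exact Equiv.Perm.cycleOf_mem_cycleFactorsFinset_iff.2
        (Equiv.Perm.mem_support.2 (hmove i hy))
  · intro y _ hy y' _ hy' h
    induction y using Quotient.inductionOn with
    | _ i =>
      induction y' using Quotient.inductionOn with
      | _ j =>
        exact Quotient.sound ((Equiv.Perm.sameCycle_iff_cycleOf_eq_of_mem_support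
          (Equiv.Perm.mem_support.2 (hmove i hy)) (Equiv.Perm.mem_support.2 (hmove j hy'))).2 h)
  · intro c hc hc1
    obtain ⟨i, hi⟩ := (Equiv.Perm.mem_cycleFactorsFinset_iff.1 hc).1.nonempty_support
    have hci := Equiv.Perm.cycle_is_cycleOf hi hc
    exact ⟨Quotient.mk _ i, Finset.mem_univ _, by rwa [hci] at hc1, hci.symm⟩

/-! ### Conditions on the type in terms of cycles -/

theorem mem_parts_typeOf_iff [Finite Γ] (x : Wreath Γ n) (c : ConjClasses Γ) (m : ℕ) :
    m ∈ (typeOf x).parts c ↔ ∃ y, cycleClass x y = c ∧ cycleLength x y = m := by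
  change m ∈ typeParts x c ↔ _
  simp [typeParts]

theorem allOdd_typeOf_iff [Finite Γ] (x : Wreath Γ n) :
    (typeOf x).AllOdd ↔ ∀ i, Odd (Function.minimalPeriod x.right i) := by
  constructor
  · intro h i
    exact h _ _ ((mem_parts_typeOf_iff x _ _).2 ⟨Quotient.mk _ i, rfl, rfl⟩)
  · intro h c m hm
    obtain ⟨y, -, rfl⟩ := (mem_parts_typeOf_iff x c m).1 hm
    induction y using Quotient.inductionOn with
    | _ i => exact h i

theorem strict_typeOf_iff [Finite Γ] (x : Wreath Γ n) :
    (typeOf x).Strict ↔ ∀ i j, Function.minimalPeriod x.right i = Function.minimalPeriod x.right j →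
      IsConj (cycleProd x i) (cycleProd x j) → x.right.SameCycle i j := by
  have hn : (typeOf x).Strict ↔ ∀ c y, cycleClass x y = c → ∀ y', cycleClass x y' = c →
      cycleLength x y = cycleLength x y' → y = y' := by
    refine forall_congr' fun c => ?_
    change (typeParts x c).Nodup ↔ _
    rw [typeParts, Multiset.nodup_map_iff_inj_on (Finset.nodup _)]
    simp
  rw [hn]
  constructor
  · intro h i j hij hc
    exact Quotient.exact (h (ConjClasses.mk (cycleProd x j)) (Quotient.mk _ i)
      (ConjClasses.mk_eq_mk_iff_isConj.2 hc) (Quotient.mk _ j) rfl hij)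
  · intro h c y hy y' hy' hl
    have hcc := hy.trans hy'.symm
    induction y using Quotient.inductionOn with
    | _ i =>
      induction y' using Quotient.inductionOn with
      | _ j => exact Quotient.sound (h i j hl (ConjClasses.mk_eq_mk_iff_isConj.1 hcc))

theorem length_typeOf [Finite Γ] (x : Wreath Γ n) :
    (typeOf x).length = Nat.card (Cycles x.right) := by
  classical
  let _ : Fintype (ConjClasses Γ) := Fintype.ofFinite _
  have hcard : ∀ c, ((typeOf x).parts c).card = Nat.card {y // cycleClass x y = c} := by
    intro c
    change (typeParts x c).card = _
    rw [typeParts, Multiset.card_map, Nat.card_eq_fintype_card, Fintype.card_subtype]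
    rfl
  rw [PartitionFun.length, finsum_eq_sum_of_fintype]
  simp_rw [hcard]
  rw [← Nat.card_sigma, Nat.card_congr (Equiv.sigmaFiberEquiv _)]

theorem odd_d_typeOf_iff [Finite Γ] (x : Wreath Γ n) :
    Odd (typeOf x).d ↔ Equiv.Perm.sign x.right = -1 := by
  classical
  have h : Equiv.Perm.sign x.right = (-1) ^ (n + (typeOf x).length) := by
    rw [sign_eq_prod_cycleLength, Finset.prod_pow_eq_pow_sum, Finset.sum_add_distrib,
      sum_cycleLength, length_typeOf, Finset.sum_const, smul_eq_mul, mul_one, Finset.card_univ,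
      Nat.card_eq_fintype_card]
  rw [h, PartitionFun.d, Int.odd_sub, Int.odd_coe_nat, Int.even_coe_nat]
  rcases Nat.even_or_odd (n + (typeOf x).length) with hp | hp
  · rw [hp.neg_one_pow]
    rw [Nat.even_add] at hp
    simp [← Nat.not_even_iff_odd, hp]
  · rw [hp.neg_one_pow]
    rw [Nat.odd_add] at hp
    simp [hp]

/-! ### Splitting classes -/

theorem splitsIntoTwo_of_odd (x : Wreath Γ n)
    (h : ∀ i, Odd (Function.minimalPeriod x.right i)) :
    SplitsIntoTwo (wreathTheta Γ n ⁻¹' (ConjClasses.mk x).carrier) := by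
  rw [splitsIntoTwo_iff]
  intro w hw a b ha hb
  obtain ⟨m, hm, hxm⟩ := exists_odd_pow_eq_one h
  refine mul_comm_of_odd_pow_eq_one ?_ hm (by rw [hb, hxm])
  rw [ha, hb]
  exact congrArg SemidirectProduct.right hw

theorem splitsIntoTwo_of_strict (x : Wreath Γ n) (hx : Equiv.Perm.sign x.right = -1)
    (h : ∀ i j, Function.minimalPeriod x.right i = Function.minimalPeriod x.right j →
      IsConj (cycleProd x i) (cycleProd x j) → x.right.SameCycle i j) :
    SplitsIntoTwo (wreathTheta Γ n ⁻¹' (ConjClasses.mk x).carrier) := by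
  rw [splitsIntoTwo_iff]
  intro w hw a b ha hb
  have hwx : w * x * w⁻¹ = x := by rw [hw, mul_inv_cancel_right]
  refine mul_comm_of_sameCycle (hb ▸ hx) _ a rfl ?_ fun i => ?_
  · rw [ha, hb]
    exact congrArg SemidirectProduct.right hw
  · rw [ha, hb]
    refine h _ _ ?_ ?_
    · have h1 := conj_minimalPeriod w x i
      rw [hwx] at h1
      exact h1.symm
    · have h1 := conj_cycleProd w x i
      rwa [hwx] at h1

/-! ### Classes that do not split -/

theorem wreath_mul_left_apply (w x : Wreath Γ n) (i : Fin n) :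
    (w * x).left i = w.left i * x.left (w.right⁻¹ i) := rfl

/-- Commutation in the wreath product. The left components are compared at the points
`x.right (w.right i)`, so that no inverse permutation occurs. -/
theorem wreath_mul_comm_of_apply {w x : Wreath Γ n}
    (hr : ∀ i, w.right (x.right i) = x.right (w.right i))
    (hl : ∀ i, w.left (x.right (w.right i)) * x.left (x.right i) =
      x.left (x.right (w.right i)) * w.left (w.right i)) : w * x = x * w := by
  have hr' : w.right * x.right = x.right * w.right := Equiv.ext hr
  refine SemidirectProduct.ext (funext fun j => ?_) hr'
  obtain ⟨i, rfl⟩ := (w.right * x.right).surjective j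
  rw [wreath_mul_left_apply, wreath_mul_left_apply]
  conv_rhs => rw [hr']
  rw [Equiv.Perm.mul_apply, Equiv.Perm.mul_apply, hr]
  rw [show w.right⁻¹ (x.right (w.right i)) = x.right i by rw [← hr]; simp,
    show x.right⁻¹ (x.right (w.right i)) = w.right i by simp]
  exact hl i

open Classical in
/-- The restriction of `x` to the cycle of `x.right` through `i`. -/
def cycleRestrict (x : Wreath Γ n) (i : Fin n) : Wreath Γ n :=
  ⟨fun j => if x.right.SameCycle i j then x.left j else 1, x.right.cycleOf i⟩

theorem cycleRestrict_mul_comm (x : Wreath Γ n) (i : Fin n) :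
    cycleRestrict x i * x = x * cycleRestrict x i := by
  refine wreath_mul_comm_of_apply (fun j => ?_) (fun j => ?_)
  · change x.right.cycleOf i (x.right j) = x.right (x.right.cycleOf i j)
    simp only [Equiv.Perm.cycleOf_apply, Equiv.Perm.sameCycle_apply_right]
    split_ifs <;> rfl
  · simp only [cycleRestrict, Equiv.Perm.cycleOf_apply, Equiv.Perm.sameCycle_apply_right]
    by_cases h : x.right.SameCycle i j <;> simp [h]

theorem not_splitsIntoTwo_of_even (x : Wreath Γ n) (hx : Equiv.Perm.sign x.right = 1) {i : Fin n}
    (hi : Even (Function.minimalPeriod x.right i)) :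
    ¬SplitsIntoTwo (wreathTheta Γ n ⁻¹' (ConjClasses.mk x).carrier) := by
  rw [splitsIntoTwo_iff]
  intro H
  obtain ⟨b, hb⟩ := theta_surjective x.right
  obtain ⟨e, he⟩ := theta_surjective (x.right.cycleOf i)
  have h1 := mul_eq_koszul_mul_of_cycleOf (b := b) (e := e) (i := i) (by rw [he, hb])
  rw [he, hb, hx, one_mul, sign_cycleOf, pow_succ, hi.neg_one_pow, one_mul, koszul_neg_one] at h1
  have h2 := H _ (cycleRestrict_mul_comm x i) e b he hb
  exact ne_spinZ_mul_self _ (h2.symm.trans h1)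

open Classical in
/-- The function with value `F m` at `(σ ^ m) i` and value `d j` at the points `j` outside the cycle
of `σ` through `i`. The exponent `m` is an arbitrary choice, immaterial only if the length of that
cycle is a period of `F`. -/
def cycleFun {β : Type*} (σ : Equiv.Perm (Fin n)) (i : Fin n) (F : ℕ → β) (d : Fin n → β)
    (j : Fin n) : β :=
  if h : ∃ m : ℕ, (σ ^ m) i = j then F h.choose else d j

theorem cycleFun_pow_apply {β : Type*} {σ : Equiv.Perm (Fin n)} {i : Fin n} {F : ℕ → β}
    (hF : Function.Periodic F (Function.minimalPeriod σ i)) (d : Fin n → β) (m : ℕ) :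
    cycleFun σ i F d ((σ ^ m) i) = F m := by
  have h : ∃ m' : ℕ, (σ ^ m') i = (σ ^ m) i := ⟨m, rfl⟩
  rw [cycleFun, dif_pos h, ← hF.map_mod_nat, ← hF.map_mod_nat m]
  congr 1
  have hpos : 0 < Function.minimalPeriod σ i :=
    Function.minimalPeriod_pos_of_mem_periodicPts (σ.injective.mem_periodicPts i)
  refine (Function.iterate_eq_iterate_iff_of_lt_minimalPeriod (Nat.mod_lt _ hpos)
    (Nat.mod_lt _ hpos)).1 ?_
  rw [Function.iterate_mod_minimalPeriod_eq, Function.iterate_mod_minimalPeriod_eq,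
    ← Equiv.Perm.coe_pow, ← Equiv.Perm.coe_pow]
  exact h.choose_spec

theorem cycleFun_of_not_sameCycle {β : Type*} {σ : Equiv.Perm (Fin n)} {i j : Fin n}
    (F : ℕ → β) (d : Fin n → β) (h : ¬σ.SameCycle i j) : cycleFun σ i F d j = d j :=
  dif_neg fun ⟨m, hm⟩ => h ⟨m, by simpa using hm⟩

theorem periodic_pow_apply {σ : Equiv.Perm (Fin n)} {i : Fin n} {k : ℕ}
    (hk : Function.minimalPeriod σ i = k) : Function.Periodic (fun m : ℕ => (σ ^ m) i) k := by
  intro m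
  subst hk
  change (σ ^ (m + _)) i = (σ ^ m) i
  rw [pow_add, Equiv.Perm.mul_apply, pow_minimalPeriod]

theorem partialProd_add_minimalPeriod (x : Wreath Γ n) (i : Fin n) (m : ℕ) :
    partialProd x i (m + Function.minimalPeriod x.right i) = partialProd x i m * cycleProd x i := by
  induction m with
  | zero => simp [partialProd, cycleProd]
  | succ m ih =>
    rw [Nat.succ_add, partialProd_succ, ih, partialProd_succ, pow_add, Equiv.Perm.mul_apply,
      pow_minimalPeriod, mul_assoc]

theorem cycleFun_cycleFun_right {β : Type*} {σ : Equiv.Perm (Fin n)} {i j : Fin n}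
    {F F' : ℕ → β} {d : Fin n → β} (h : ¬σ.SameCycle i j)
    (hF' : Function.Periodic F' (Function.minimalPeriod σ j)) (m : ℕ) :
    cycleFun σ i F (cycleFun σ j F' d) ((σ ^ m) j) = F' m := by
  rw [cycleFun_of_not_sameCycle _ _ (by simpa using h), cycleFun_pow_apply hF']

theorem mem_cycle_cases (σ : Equiv.Perm (Fin n)) (i j l : Fin n) :
    (∃ m : ℕ, l = (σ ^ m) i) ∨ (∃ m : ℕ, l = (σ ^ m) j) ∨
      ¬σ.SameCycle i l ∧ ¬σ.SameCycle j l := by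
  by_cases hi : σ.SameCycle i l
  · obtain ⟨m, hm⟩ := hi.exists_nat_pow_eq
    exact Or.inl ⟨m, hm.symm⟩
  by_cases hj : σ.SameCycle j l
  · obtain ⟨m, hm⟩ := hj.exists_nat_pow_eq
    exact Or.inr (Or.inl ⟨m, hm.symm⟩)
  exact Or.inr (Or.inr ⟨hi, hj⟩)

/-- Two distinct cycles of the same length and with conjugate cycle products are exchanged by an
element that commutes with `x`. -/
theorem exists_cycleSwap (x : Wreath Γ n) {i j : Fin n} (hij : ¬x.right.SameCycle i j)
    (hp : Function.minimalPeriod x.right i = Function.minimalPeriod x.right j)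
    (hc : IsConj (cycleProd x i) (cycleProd x j)) :
    ∃ w : Wreath Γ n, w * x = x * w ∧ w.right * w.right = 1 ∧ w.right i = j ∧
      ∀ l, ¬x.right.SameCycle i l → ¬x.right.SameCycle j l → w.right l = l := by
  obtain ⟨σ, hσ⟩ : ∃ σ, x.right = σ := ⟨_, rfl⟩
  rw [hσ] at hij hp
  have hji : ¬σ.SameCycle j i := fun h => hij h.symm
  let T : Fin n → Fin n := cycleFun σ i (fun m => (σ ^ m) j) (cycleFun σ j (fun m => (σ ^ m) i) id)
  have Ti : ∀ m : ℕ, T ((σ ^ m) i) = (σ ^ m) j :=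
    cycleFun_pow_apply (periodic_pow_apply hp.symm) _
  have Tj : ∀ m : ℕ, T ((σ ^ m) j) = (σ ^ m) i :=
    cycleFun_cycleFun_right hij (periodic_pow_apply hp)
  have To : ∀ l, ¬σ.SameCycle i l → ¬σ.SameCycle j l → T l = l := by
    intro l hi hj
    change cycleFun σ i _ _ l = l
    rw [cycleFun_of_not_sameCycle _ _ hi, cycleFun_of_not_sameCycle _ _ hj, id]
  have hT : Function.Involutive T := by
    intro l
    rcases mem_cycle_cases σ i j l with ⟨m, rfl⟩ | ⟨m, rfl⟩ | ⟨hi, hj⟩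
    · rw [Ti, Tj]
    · rw [Tj, Ti]
    · rw [To l hi hj, To l hi hj]
  -- `a` conjugates the cycle products based at `σ i` and `σ j`
  obtain ⟨a, ha⟩ := isConj_iff.1 (((hσ ▸ isConj_cycleProd_right x j).symm.trans hc.symm).trans
    (hσ ▸ isConj_cycleProd_right x i))
  have hai : a * cycleProd x (σ j) = cycleProd x (σ i) * a := mul_inv_eq_iff_eq_mul.1 ha
  have haj : a⁻¹ * cycleProd x (σ i) = cycleProd x (σ j) * a⁻¹ := by rw [← ha]; group
  have hper : ∀ (u v : Fin n) (y : Γ),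
      Function.minimalPeriod σ u = Function.minimalPeriod σ v →
      y * cycleProd x (σ v) = cycleProd x (σ u) * y →
      Function.Periodic (fun m => partialProd x (σ u) m * y * (partialProd x (σ v) m)⁻¹)
        (Function.minimalPeriod σ u) := by
    intro u v y huv hy m
    have h1 := partialProd_add_minimalPeriod x (σ u) m
    have h2 := partialProd_add_minimalPeriod x (σ v) m
    rw [hσ, minimalPeriod_right] at h1 h2
    rw [← huv] at h2
    change partialProd x (σ u) (m + _) * y * (partialProd x (σ v) (m + _))⁻¹ = _
    rw [h1, h2, mul_assoc _ _ y, ← hy]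
    group
  -- `h` solves `h (σ l) = g (σ l) * h l * (g (τ (σ l)))⁻¹`; it closes up around the cycles by the
  -- choice of `a`
  let h : Fin n → Γ := cycleFun σ i (fun m => partialProd x (σ i) m * a * (partialProd x (σ j) m)⁻¹)
    (cycleFun σ j (fun m => partialProd x (σ j) m * a⁻¹ * (partialProd x (σ i) m)⁻¹) 1)
  have h_i : ∀ m : ℕ, h ((σ ^ m) i) = partialProd x (σ i) m * a * (partialProd x (σ j) m)⁻¹ :=
    cycleFun_pow_apply (hper i j a hp hai) _
  have h_j : ∀ m : ℕ, h ((σ ^ m) j) = partialProd x (σ j) m * a⁻¹ * (partialProd x (σ i) m)⁻¹ :=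
    cycleFun_cycleFun_right hij (hper j i a⁻¹ hp.symm haj)
  have h_o : ∀ l, ¬σ.SameCycle i l → ¬σ.SameCycle j l → h l = 1 := by
    intro l hi hj
    change cycleFun σ i _ _ l = 1
    rw [cycleFun_of_not_sameCycle _ _ hi, cycleFun_of_not_sameCycle _ _ hj, Pi.one_apply]
  have hsucc : ∀ (m : ℕ) (u : Fin n), σ ((σ ^ m) u) = (σ ^ (m + 1)) u := by
    intro m u
    rw [pow_succ', Equiv.Perm.mul_apply]
  have hxsucc : ∀ (m : ℕ) (u : Fin n),
      partialProd x (σ u) (m + 1) = x.left ((σ ^ (m + 1)) u) * partialProd x (σ u) m := by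
    intro m u
    rw [partialProd_succ, hσ, pow_succ, Equiv.Perm.mul_apply]
  refine ⟨⟨h, hT.toPerm T⟩, wreath_mul_comm_of_apply (fun l => ?_) (fun l => ?_), Equiv.ext hT,
    Ti 0, hσ ▸ To⟩
  · change T (x.right l) = x.right (T l)
    rw [hσ]
    rcases mem_cycle_cases σ i j l with ⟨m, rfl⟩ | ⟨m, rfl⟩ | ⟨hi, hj⟩
    · rw [hsucc, Ti, Ti, hsucc]
    · rw [hsucc, Tj, Tj, hsucc]
    · rw [To l hi hj, To _ (by simpa using hi) (by simpa using hj)]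
  · change h (x.right (T l)) * x.left (x.right l) = x.left (x.right (T l)) * h (T l)
    rw [hσ]
    rcases mem_cycle_cases σ i j l with ⟨m, rfl⟩ | ⟨m, rfl⟩ | ⟨hi, hj⟩
    · rw [Ti, hsucc, hsucc, h_j, h_j, hxsucc, hxsucc]
      group
    · rw [Tj, hsucc, hsucc, h_i, h_i, hxsucc, hxsucc]
      group
    · rw [To l hi hj, h_o l hi hj, h_o _ (by simpa using hi) (by simpa using hj), one_mul, mul_one]

theorem sameCycle_apply_iff_of_comm {σ τ : Equiv.Perm (Fin n)} (h : τ * σ = σ * τ) (i j : Fin n) :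
    σ.SameCycle (τ i) (τ j) ↔ σ.SameCycle i j := by
  have h1 := Equiv.Perm.sameCycle_conj (f := σ) (g := τ) (x := τ i) (y := τ j)
  simpa [h] using h1

theorem conj_cycleOf_of_comm {σ τ : Equiv.Perm (Fin n)} (h : τ * σ = σ * τ) (i : Fin n) :
    τ * σ.cycleOf i * τ⁻¹ = σ.cycleOf (τ i) := by
  ext l
  obtain ⟨l, rfl⟩ := τ.surjective l
  have h2 : τ (σ l) = σ (τ l) := DFunLike.congr_fun h l
  simp only [Equiv.Perm.mul_apply, Equiv.Perm.cycleOf_apply, sameCycle_apply_iff_of_comm h]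
  simp only [Equiv.Perm.inv_def, Equiv.symm_apply_apply]
  split_ifs
  · rw [h2]
  · rfl

/-- An involution that commutes with `σ`, exchanges two of its cycles, of length `k`, and fixes all
other points is a product of `k` transpositions. -/
theorem sign_of_cycleSwap {σ τ : Equiv.Perm (Fin n)} {i : Fin n} (h : τ * σ = σ * τ)
    (hij : ¬σ.SameCycle i (τ i)) (hτ : τ * τ = 1)
    (hfix : ∀ l, ¬σ.SameCycle i l → ¬σ.SameCycle (τ i) l → τ l = l) :
    Equiv.Perm.sign τ = (-1) ^ Function.minimalPeriod σ i := by
  classical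
  let A : Finset (Fin n) := Finset.univ.filter fun l => σ.SameCycle i l
  let B : Finset (Fin n) := Finset.univ.filter fun l => σ.SameCycle (τ i) l
  have hττ : ∀ l, τ (τ l) = l := fun l => DFunLike.congr_fun hτ l
  have hAB : Disjoint A B := Finset.disjoint_left.2 fun l hA hB =>
    hij ((Finset.mem_filter.1 hA).2.trans (Finset.mem_filter.1 hB).2.symm)
  have hB : B = A.map τ.toEmbedding := by
    ext l
    obtain ⟨l, rfl⟩ := τ.surjective l
    simp [A, B, sameCycle_apply_iff_of_comm h]
  have hcard : (A ∪ B).card = 2 * Function.minimalPeriod σ i := by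
    rw [Finset.card_union_of_disjoint hAB, hB, Finset.card_map, minimalPeriod_eq_card, two_mul]
  have hsupp : Fintype.card (Function.fixedPoints τ) = (A ∪ B)ᶜ.card := by
    rw [← Set.toFinset_card]
    congr 1
    ext l
    simp only [Set.mem_toFinset, Function.mem_fixedPoints, Function.IsFixedPt, Finset.mem_compl,
      Finset.mem_union, A, B, Finset.mem_filter, Finset.mem_univ, true_and, not_or]
    refine ⟨fun hl => ⟨fun hi => ?_, fun hj => ?_⟩, fun hl => hfix l hl.1 hl.2⟩
    · have := (sameCycle_apply_iff_of_comm h i l).2 hi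
      rw [hl] at this
      exact hij (hi.trans this.symm)
    · rw [← hl, sameCycle_apply_iff_of_comm h] at hj
      have := (sameCycle_apply_iff_of_comm h i l).2 hj
      rw [hl] at this
      exact hij (hj.trans this.symm)
  have hle : (A ∪ B).card ≤ Fintype.card (Fin n) := Finset.card_le_univ _
  rw [Equiv.Perm.sign_of_pow_two_eq_one (by rw [pow_two, hτ]), hsupp, Finset.card_compl,
    Nat.sub_sub_self hle, hcard, Nat.mul_div_cancel_left _ two_pos]

/-- If `σ` is odd, lifts of `σ` and of an involution that exchanges two cycles of `σ` and
fixes all other points do not commute. -/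
theorem mul_eq_spinZ_mul_of_cycleSwap {a b : SpinGroup n} {i : Fin n}
    (h : theta n a * theta n b = theta n b * theta n a)
    (hij : ¬(theta n b).SameCycle i (theta n a i)) (ha : theta n a * theta n a = 1)
    (hfix : ∀ l, ¬(theta n b).SameCycle i l → ¬(theta n b).SameCycle (theta n a i) l →
      theta n a l = l)
    (hb : Equiv.Perm.sign (theta n b) = -1) : a * b = spinZ n * (b * a) := by
  obtain ⟨e, he⟩ := theta_surjective ((theta n b).cycleOf i)
  obtain ⟨f, hf⟩ : ∃ f, f = a * e * a⁻¹ := ⟨_, rfl⟩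
  have hθf : theta n f = (theta n b).cycleOf (theta n a i) := by
    rw [hf, map_mul, map_mul, map_inv, he, conj_cycleOf_of_comm h]
  have hae : a * e = f * a := by rw [hf]; group
  have haf : a * f = e * a := by
    have haa : a * a * e = e * (a * a) := by
      rcases eq_one_or_eq_spinZ_of_theta_eq_one (a := a * a) (by rw [map_mul, ha]) with h | h <;>
        rw [h]
      · simp
      · exact spinZ_comm e
    rw [hf, ← mul_assoc, ← mul_assoc, haa]
    group
  have hsf : Equiv.Perm.sign (theta n f) = Equiv.Perm.sign (theta n e) := by
    rw [hf, map_mul, map_mul, map_mul, map_mul, mul_right_comm, ← map_mul, ← map_mul]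
    simp
  -- `b = r * (e * f)`, where `r` lies over the product of the remaining cycles
  obtain ⟨r, hr⟩ : ∃ r, b = r * (e * f) := ⟨b * (e * f)⁻¹, by group⟩
  have hce : ∀ l, (theta n b).SameCycle i l → theta n e l = theta n b l := fun l hl => by
    rw [he, hl.cycleOf_apply]
  have hce' : ∀ l, ¬(theta n b).SameCycle i l → theta n e l = l := fun l hl => by
    rw [he, Equiv.Perm.cycleOf_apply_of_not_sameCycle hl]
  have hcf : ∀ l, (theta n b).SameCycle (theta n a i) l → theta n f l = theta n b l :=
    fun l hl => by rw [hθf, hl.cycleOf_apply]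
  have hcf' : ∀ l, ¬(theta n b).SameCycle (theta n a i) l → theta n f l = l :=
    fun l hl => by rw [hθf, Equiv.Perm.cycleOf_apply_of_not_sameCycle hl]
  have hef : (theta n e).Disjoint (theta n f) := by
    intro l
    by_cases hl : (theta n b).SameCycle i l
    · exact Or.inr (hcf' l fun hl' => hij (hl.trans hl'.symm))
    · exact Or.inl (hce' l hl)
  have hrefl : ∀ l, theta n r (theta n e (theta n f l)) = theta n b l := by
    intro l
    rw [hr]
    simp [Equiv.Perm.mul_apply]
  have har : (theta n a).Disjoint (theta n r) := by
    intro l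
    by_cases hi : (theta n b).SameCycle i l
    · right
      obtain ⟨l, rfl⟩ := (theta n b).surjective l
      rw [Equiv.Perm.sameCycle_apply_right] at hi
      have h1 := hrefl l
      rwa [hcf' l fun hl' => hij (hi.trans hl'.symm), hce l hi] at h1
    by_cases hj : (theta n b).SameCycle (theta n a i) l
    · right
      obtain ⟨l, rfl⟩ := (theta n b).surjective l
      rw [Equiv.Perm.sameCycle_apply_right] at hj
      have h1 := hrefl l
      rwa [hcf l hj, hce' _ hi] at h1
    · exact Or.inl (hfix l hi hj)
  have hsr : Equiv.Perm.sign (theta n r) = -1 := by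
    rw [hr, map_mul, map_mul, map_mul, map_mul, hsf, Int.units_mul_self, mul_one] at hb
    exact hb
  have har' := mul_eq_koszul_mul_of_disjoint har
  have hef' := mul_eq_koszul_mul_of_disjoint hef
  rw [hsr, sign_of_cycleSwap h hij ha hfix] at har'
  rw [hsf, he, sign_cycleOf] at hef'
  -- exactly one of the two signs is `z`, according to the parity of the length of the cycles
  have hsign : ∀ k : ℕ, koszul n ((-1) ^ k) (-1) * koszul n ((-1) ^ (k + 1)) ((-1) ^ (k + 1)) =
      spinZ n := by
    intro k
    rcases Nat.even_or_odd k with hk | hk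
    · simp [pow_succ, hk.neg_one_pow]
    · simp [pow_succ, hk.neg_one_pow]
  have hfe : f * e = koszul n ((-1) ^ (Function.minimalPeriod (theta n b) i + 1))
      ((-1) ^ (Function.minimalPeriod (theta n b) i + 1)) * (e * f) := by
    rw [hef', ← mul_assoc, koszul_mul_self, one_mul]
  calc a * b = a * r * e * f := by rw [hr]; simp only [mul_assoc]
    _ = koszul n ((-1) ^ Function.minimalPeriod (theta n b) i) (-1) * (r * (f * e) * a) := by
      rw [har', mul_assoc, mul_assoc, mul_assoc r, ← mul_assoc a, hae, mul_assoc f, haf]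
      simp only [mul_assoc]
    _ = spinZ n * (b * a) := by
      have hba : b * a = r * (e * f) * a := by rw [← hr]
      rw [hfe, ← mul_assoc r, ← koszul_comm _ _ r, hba,
        ← hsign (Function.minimalPeriod (theta n b) i)]
      simp only [mul_assoc]

theorem not_splitsIntoTwo_of_not_strict (x : Wreath Γ n) (hx : Equiv.Perm.sign x.right = -1)
    {i j : Fin n} (hij : ¬x.right.SameCycle i j)
    (hp : Function.minimalPeriod x.right i = Function.minimalPeriod x.right j)
    (hc : IsConj (cycleProd x i) (cycleProd x j)) :
    ¬SplitsIntoTwo (wreathTheta Γ n ⁻¹' (ConjClasses.mk x).carrier) := by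
  rw [splitsIntoTwo_iff]
  intro H
  obtain ⟨w, hw, hw2, rfl, hfix⟩ := exists_cycleSwap x hij hp hc
  obtain ⟨a, ha⟩ := theta_surjective w.right
  obtain ⟨b, hb⟩ := theta_surjective x.right
  have hr : w.right * x.right = x.right * w.right := congrArg SemidirectProduct.right hw
  have h1 := H w hw a b ha hb
  rw [← ha] at hij hw2 hfix hr
  rw [← hb] at hij hfix hx hr
  exact ne_spinZ_mul_self _ (h1.symm.trans (mul_eq_spinZ_mul_of_cycleSwap hr hij hw2 hfix hx))

/-! ### The splitting classes in terms of the type -/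

theorem splitsIntoTwo_iff_typeOf [Finite Γ] (x : Wreath Γ n) :
    SplitsIntoTwo (wreathTheta Γ n ⁻¹' (ConjClasses.mk x).carrier) ↔
      (Equiv.Perm.sign x.right = 1 ∧ (typeOf x).AllOdd) ∨
        (Equiv.Perm.sign x.right = -1 ∧ (typeOf x).Strict) := by
  rw [allOdd_typeOf_iff, strict_typeOf_iff]
  constructor
  · intro H
    rcases Int.units_eq_one_or (Equiv.Perm.sign x.right) with hx | hx
    · refine Or.inl ⟨hx, fun i => ?_⟩
      by_contra hi
      exact not_splitsIntoTwo_of_even x hx (Nat.not_odd_iff_even.1 hi) H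
    · refine Or.inr ⟨hx, fun i j hp hc => ?_⟩
      by_contra hij
      exact not_splitsIntoTwo_of_not_strict x hx hij hp hc H
  · rintro (⟨-, h⟩ | ⟨hx, h⟩)
    · exact splitsIntoTwo_of_odd x h
    · exact splitsIntoTwo_of_strict x hx h

theorem sign_eq_one_of_allOdd [Finite Γ] {x : Wreath Γ n} (h : (typeOf x).AllOdd) :
    Equiv.Perm.sign x.right = 1 := by
  obtain ⟨m, hm, hxm⟩ := exists_odd_pow_eq_one ((allOdd_typeOf_iff x).1 h)
  have h1 := congrArg Equiv.Perm.sign hxm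
  rcases Int.units_eq_one_or (Equiv.Perm.sign x.right) with hx | hx
  · exact hx
  · rw [map_pow, hx, hm.neg_one_pow, map_one] at h1
    exact absurd h1 (by decide)

theorem forall_mem_carrier_sign_iff (x : Wreath Γ n) (u : ℤˣ) :
    (∀ y ∈ (ConjClasses.mk x).carrier, Equiv.Perm.sign y.right = u) ↔
      Equiv.Perm.sign x.right = u := by
  constructor
  · exact fun h => h x ConjClasses.mem_carrier_mk
  · rintro h y hy
    obtain ⟨w, rfl⟩ := isConj_iff.1
      (ConjClasses.mk_eq_mk_iff_isConj.1 (ConjClasses.mem_carrier_iff_mk_eq.1 hy)).symm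
    rw [conj_right, map_mul, map_mul, mul_right_comm, ← map_mul, mul_inv_cancel, map_one, one_mul,
      h]

end SpinWreath

end

theorem theoremT (Γ : Type*) [Group Γ] [Finite Γ] (n : ℕ)
    (C : ConjClasses (SpinWreath.Wreath Γ n))
    (ρ : SpinWreath.PartitionFun (ConjClasses Γ) n) (hρ : SpinWreath.classType C = ρ) :
    (SpinWreath.SplitsIntoTwo (SpinWreath.wreathTheta Γ n ⁻¹' C.carrier) ↔
      (SpinWreath.ClassEven C ∧ ρ.AllOdd) ∨ (SpinWreath.ClassOdd C ∧ ρ.Strict)) ∧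
    ((SpinWreath.ClassEven C ∧ ρ.AllOdd) ↔ ρ ∈ SpinWreath.OP (ConjClasses Γ) n) ∧
    ((SpinWreath.ClassOdd C ∧ ρ.Strict) ↔ ρ ∈ SpinWreath.SPOdd (ConjClasses Γ) n) := by
  subst hρ
  obtain ⟨x, rfl⟩ := ConjClasses.mk_surjective C
  have heven : SpinWreath.ClassEven (ConjClasses.mk x) ↔ Equiv.Perm.sign x.right = 1 :=
    SpinWreath.forall_mem_carrier_sign_iff x 1
  have hodd : SpinWreath.ClassOdd (ConjClasses.mk x) ↔ Equiv.Perm.sign x.right = -1 :=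
    SpinWreath.forall_mem_carrier_sign_iff x (-1)
  rw [heven, hodd, show SpinWreath.classType (ConjClasses.mk x) = SpinWreath.typeOf x from rfl]
  refine ⟨SpinWreath.splitsIntoTwo_iff_typeOf x,
    ⟨fun h => h.2, fun h => ⟨SpinWreath.sign_eq_one_of_allOdd h, h⟩⟩, ?_⟩
  rw [← SpinWreath.odd_d_typeOf_iff]
  exact Iff.rfl
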